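/- **Conventions.** A *domain* is a nonempty connected open subset of $\mathbb C$. Let $K\subset\mathbb C$ be compact. * A (local holomorphic) *symmetry* of $K$ on a domain $D$ with $D\cap K\neq\emptyset$ is a holomorphic map $H:D\to\mathbb C$ such that, for $x\in D$, $x\in D\cap K\iff H(x)\in H(D)\cap K$. * A family $\mathcal H$ of symmetries of $K$ on $D$ is *non-trivial* if every sequence in $\mathcal H$ has a subsequence converging, uniformly on compact subsets of $D$, to some function $D\to\mathbb C$, and no limit (uniform on compact subsets of $D$) of a sequence in $\mathcal H$ is constant. * A point $b\in D$ is an *attracting fixed point* of a holomorphic map $H:D\to\mathbb C$ if $H(b)=b$ and $0<|H'(b)|<1$. * $K$ is *$J$-like relative to a domain* $U$ if the points of $U\cap K$ that are attracting fixed points of local holomorphic symmetries of $K$ (on arbitrary domains) form a dense subset of $U\cap K$. **Theorem.** Let $K\subset\mathbb C$ be a compact set with no isolated points that is $J$-like relative to a domain $U\subset\mathbb C$. Then at least one of the following holds: 1. every non-trivial family of symmetries of $K$ on $U$ is finite; 2. every open subset $V\subset U$ with $V\cap K\neq\emptyset$ contains a simply connected domain $\Omega$ with $\Omega\cap K\neq\emptyset$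 such that $\overline\Omega\cap K$ is analytically diffeomorphic to $[0,1]\times L$ for some compact $L\subset i\mathbb R$; that is, there is an injective holomorphic map $\psi$ on an open neighbourhood of $\overline\Omega$ with $\psi(\overline\Omega\cap K)=[0,1]\times L=\{x+y: x\in[0,1],\,y\in L\}$. -/

import Mathlib

open Set Filter Topology

/-- `D` is a domain of the plane: a nonempty connected open set. -/
def IsPlaneDomain (D : Set ℂ) : Prop :=
  IsOpen D ∧ IsConnected D

/-- `H` is a (local holomorphic) symmetry of `K` on `D`: `D` is a domain that meets `K`, `H` is
holomorphic on `D`, and for `x` in `D` we have `x ∈ D ∩ K ↔ H x ∈ H(D) ∩ K`.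
Only the values of `H` on `D` matter. -/
structure IsLocalSymmetry (K D : Set ℂ) (H : ℂ → ℂ) : Prop where
  isPlaneDomain : IsPlaneDomain D
  nonempty_inter : (D ∩ K).Nonempty
  differentiableOn : DifferentiableOn ℂ H D
  mem_iff : ∀ x ∈ D, (x ∈ D ∩ K ↔ H x ∈ H '' D ∩ K)

/-- A non-trivial family of symmetries of `K` on `D`: every member is a symmetry of `K` on `D`,
every sequence in the family has a subsequence that converges locally uniformly on `D`
(equivalently, as `D` is open, uniformly on compact subsets of `D`), and no limit, locally uniform
on `D`, of a sequence in the family is constant on `D`. -/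
structure IsNontrivialSymmetryFamily (K D : Set ℂ) (F : Set (ℂ → ℂ)) : Prop where
  isLocalSymmetry : ∀ H ∈ F, IsLocalSymmetry K D H
  normal : ∀ f : ℕ → ℂ → ℂ, (∀ n, f n ∈ F) →
    ∃ φ : ℕ → ℕ, StrictMono φ ∧ ∃ g : ℂ → ℂ,
      TendstoLocallyUniformlyOn (fun k => f (φ k)) g atTop D
  limit_not_constant : ∀ f : ℕ → ℂ → ℂ, (∀ n, f n ∈ F) → ∀ g : ℂ → ℂ,
    TendstoLocallyUniformlyOn f g atTop D → ¬ ∃ c : ℂ, ∀ z ∈ D, g z = c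

/-- `b ∈ D` is an attracting fixed point of the holomorphic map `H` on the open set `D`
(the multiplier is required to be nonzero). -/
def IsAttractingFixedPoint (D : Set ℂ) (H : ℂ → ℂ) (b : ℂ) : Prop :=
  b ∈ D ∧ H b = b ∧ 0 < ‖deriv H b‖ ∧ ‖deriv H b‖ < 1

/-- The attracting fixed points of local holomorphic symmetries of `K`; the domain of the
symmetry is arbitrary. -/
def attractingFixedPoints (K : Set ℂ) : Set ℂ :=
  {b | ∃ (D : Set ℂ) (H : ℂ → ℂ), IsLocalSymmetry K D H ∧ IsAttractingFixedPoint D H b}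

/-- `K` is J-like relative to `U`: those attracting fixed points of local holomorphic symmetries
of `K` that lie in `U ∩ K` form a dense subset of `U ∩ K`. -/
def IsJLikeRelativeTo (K U : Set ℂ) : Prop :=
  U ∩ K ⊆ closure (attractingFixedPoints K ∩ (U ∩ K))

/-- `K` is laminar relative to `U`: every open subset `V` of `U` meeting `K` contains a simply
connected domain `Ω` meeting `K` such that some `ψ`, holomorphic and injective on an open
neighbourhood `W` of the closure of `Ω` (hence biholomorphic from `W` onto its image), maps
`closure Ω ∩ K` onto `[0,1] × iL` with `L ⊆ ℝ` compact. Here `s ×ℂ t` is the set of all complex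
numbers with real part in `s` and imaginary part in `t`. -/
def IsLaminarRelativeTo (K U : Set ℂ) : Prop :=
  ∀ V : Set ℂ, IsOpen V → V ⊆ U → (V ∩ K).Nonempty →
    ∃ Ω : Set ℂ, IsPlaneDomain Ω ∧ IsSimplyConnected Ω ∧ Ω ⊆ V ∧ (Ω ∩ K).Nonempty ∧
      ∃ (W : Set ℂ) (ψ : ℂ → ℂ) (L : Set ℝ),
        IsOpen W ∧ closure Ω ⊆ W ∧ DifferentiableOn ℂ ψ W ∧ InjOn ψ W ∧
        IsCompact L ∧ ψ '' (closure Ω ∩ K) = Icc (0 : ℝ) 1 ×ℂ L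

/-!
Suppose that some non-trivial family of symmetries of `K` on `U` is infinite, so that it contains
pairwise distinct `H n` converging to a nonconstant `H`. In an open set meeting `K`, density gives
an attracting fixed point `b ∈ K` of a local symmetry `G` with `H' b ≠ 0`. In the Koenigs
coordinate at `b` (`exists_koenigs_parametrization`) the map `G` is `z ↦ l z` with `0 < |l| < 1`,
and `K` becomes a set `A` with `z ∈ A ↔ l z ∈ A`. The maps `H⁻¹ ∘ H n` are symmetries of `A` near
`0`, tend to the identity, and all but at most one of them differ from it
(`exists_near_identity_symmetries`).

Conjugating a symmetry `id + w` by `lᵏ` gives the symmetry `z + l⁻ᵏ w (lᵏ z)`. For suitable `w`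
and `k` its second term is arbitrarily small and uniformly dominated by a single monomial
(`exists_rescaling_near_monomial`), so a vector field `c zᵐ` with `|c| = 1` is an infinitesimal
symmetry of `A` (`exists_isInfinitesimalSymmetry_monomial`). As `K` has no isolated points, `A`
contains points `p ≠ 0` near `0`, where this field does not vanish. In the coordinate `ζ` with
`ζ' = 1 / (c zᵐ)` the symmetries are translations by `ε (1 + o(1))`, and iterating them about `t / ε`
times shows that `A` is invariant under real translations near `p`
(`exists_rectifying_parametrization`). A square in this coordinate is the required domain
(`exists_laminar_domain`).
-/

open Metric

/-! ### Koenigs linearization -/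

/-- The holomorphic inverse function theorem, packaged as a biholomorphic partial homeomorphism
whose source lies in a prescribed open set. -/
theorem exists_biholomorphic_openPartialHomeomorph {h : ℂ → ℂ} {O : Set ℂ} {p : ℂ}
    (hO : IsOpen O) (hh : DifferentiableOn ℂ h O) (hp : p ∈ O) (hd : deriv h p ≠ 0) :
    ∃ e : OpenPartialHomeomorph ℂ ℂ, (e : ℂ → ℂ) = h ∧ p ∈ e.source ∧ e.source ⊆ O ∧
      DifferentiableOn ℂ e.symm e.target := by
  have han : AnalyticAt ℂ h p := hh.analyticAt (hO.mem_nhds hp)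
  have hs : HasStrictDerivAt h (deriv h p) p := han.hasStrictDerivAt
  let e₀ := (hs.hasStrictFDerivAt_equiv hd).toOpenPartialHomeomorph h
  have hp₀ : p ∈ e₀.source := (hs.hasStrictFDerivAt_equiv hd).mem_toOpenPartialHomeomorph_source
  have hO' : IsOpen (O ∩ (deriv h) ⁻¹' {0}ᶜ) :=
    (hh.deriv hO).continuousOn.isOpen_inter_preimage hO isOpen_compl_singleton
  let e := e₀.restrOpen _ hO'
  have hsrc : e.source = e₀.source ∩ (O ∩ (deriv h) ⁻¹' {0}ᶜ) := rfl
  have hcoe : (e : ℂ → ℂ) = h := rfl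
  refine ⟨e, hcoe, ?_, ?_, ?_⟩
  · rw [hsrc]; exact ⟨hp₀, hp, hd⟩
  · rw [hsrc]; exact fun x hx => hx.2.1
  · intro y hy
    have hx : e.symm y ∈ e.source := e.map_target hy
    rw [hsrc] at hx
    have := e.hasDerivAt_symm hy hx.2.2
      (by rw [hcoe]; exact (hh.differentiableAt (hO.mem_nhds hx.2.1)).hasDerivAt)
    exact this.differentiableAt.differentiableWithinAt

/-- **Koenigs linearization** at an attracting fixed point `0`. The linearizing function is the
limit of `λ⁻ⁿ gⁿ`, written as a telescoping series; the series converges because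
`g z - λ z = O(z²)` and `gⁿ z = O(qⁿ)` for some `q` with `q² < |λ|`. -/
theorem exists_koenigs_linearization {g : ℂ → ℂ} {O : Set ℂ} (hO : IsOpen O) (h0 : (0 : ℂ) ∈ O)
    (hg : DifferentiableOn ℂ g O) (hg0 : g 0 = 0) (hpos : 0 < ‖deriv g 0‖)
    (hlt : ‖deriv g 0‖ < 1) :
    ∃ ρ > 0, ball 0 ρ ⊆ O ∧
      ∃ φ : ℂ → ℂ, DifferentiableOn ℂ φ (ball 0 ρ) ∧ φ 0 = 0 ∧ deriv φ 0 = 1 ∧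
        ∀ z ∈ ball (0 : ℂ) ρ, φ (g z) = deriv g 0 * φ z := by
  set l := deriv g 0 with hl
  have hl0 : l ≠ 0 := norm_pos_iff.mp hpos
  obtain ⟨q, hq1, hq2⟩ : ∃ q, ‖l‖ < q ∧ q < √‖l‖ := exists_between (by
    rw [Real.lt_sqrt hpos.le]; nlinarith)
  have hq0 : 0 < q := hpos.trans hq1
  have hqq : q ^ 2 < ‖l‖ := (Real.lt_sqrt hq0.le).mp hq2
  have hq1' : q < 1 := by nlinarith
  -- the quadratic estimate `‖g z - l z‖ ≤ C ‖z‖²`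
  have hslope : DifferentiableAt ℂ (dslope g 0) 0 :=
    ((Complex.differentiableOn_dslope (hO.mem_nhds h0)).mpr hg).differentiableAt (hO.mem_nhds h0)
  obtain ⟨C, hC⟩ := hslope.isBigO_sub.bound
  obtain ⟨ρ₁, hρ₁, hb₁⟩ := Metric.eventually_nhds_iff_ball.mp (hC.and (hO.mem_nhds h0))
  set C' := max C 1 with hC'
  have hC'1 : 0 < C' := by positivity
  set ρ := min ρ₁ ((q - ‖l‖) / C') with hρ
  have hρ0 : 0 < ρ := lt_min hρ₁ (div_pos (sub_pos.mpr hq1) hC'1)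
  have hCρ : C' * ρ ≤ q - ‖l‖ := by
    have := min_le_right ρ₁ ((q - ‖l‖) / C')
    rw [le_div_iff₀ hC'1] at this; linarith
  have hquad : ∀ z ∈ ball (0 : ℂ) ρ, ‖g z - l * z‖ ≤ C' * ‖z‖ ^ 2 := by
    intro z hz
    have h1 := (hb₁ z (ball_subset_ball (min_le_left _ _) hz)).1
    rw [dslope_same, sub_zero] at h1
    have h2 : g z - l * z = (dslope g 0 z - l) * z := by
      have := sub_smul_dslope g 0 z
      simp only [sub_zero, smul_eq_mul, hg0] at this
      rw [← this]; ring
    rw [h2, norm_mul, pow_two, ← mul_assoc]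
    gcongr
    exact h1.trans (by gcongr; exact le_max_left _ _)
  have hcontr : ∀ z ∈ ball (0 : ℂ) ρ, ‖g z‖ ≤ q * ‖z‖ := by
    intro z hz
    have h1 := hquad z hz
    have h2 : ‖g z‖ ≤ ‖g z - l * z‖ + ‖l * z‖ := by
      simpa using norm_add_le (g z - l * z) (l * z)
    rw [norm_mul] at h2
    have h3 : C' * ‖z‖ ≤ q - ‖l‖ :=
      (mul_le_mul_of_nonneg_left (mem_ball_zero_iff.mp hz).le hC'1.le).trans hCρ
    nlinarith [norm_nonneg z]
  have hmaps : MapsTo g (ball 0 ρ) (ball 0 ρ) := by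
    intro z hz
    have := hcontr z hz
    rw [mem_ball_zero_iff] at hz ⊢
    nlinarith [norm_nonneg z]
  have hsub : ball 0 ρ ⊆ O := fun z hz => (hb₁ z (ball_subset_ball (min_le_left _ _) hz)).2
  have hit : ∀ n, MapsTo g^[n] (ball 0 ρ) (ball 0 ρ) := fun n => hmaps.iterate n
  have hitn : ∀ n, ∀ z ∈ ball (0 : ℂ) ρ, ‖g^[n] z‖ ≤ q ^ n * ‖z‖ := by
    intro n z hz
    induction n with
    | zero => simp
    | succ n ih =>
      rw [Function.iterate_succ_apply']
      refine (hcontr _ (hit n hz)).trans ?_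
      rw [pow_succ']; nlinarith
  have hitd : ∀ n, DifferentiableOn ℂ g^[n] (ball 0 ρ) := by
    intro n
    induction n with
    | zero => exact differentiableOn_id
    | succ n ih =>
      rw [Function.iterate_succ']
      exact (hg.mono hsub).comp ih (hit n)
  let u : ℕ → ℂ → ℂ := fun n z => (l ^ (n + 1))⁻¹ * (g (g^[n] z) - l * g^[n] z)
  have hu : ∀ n, ∀ z ∈ ball (0 : ℂ) ρ, ‖u n z‖ ≤ (C' / ‖l‖ * ‖z‖ ^ 2) * (q ^ 2 / ‖l‖) ^ n := by
    intro n z hz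
    have h1 := hquad _ (hit n hz)
    have h2 := hitn n z hz
    have h3 : ‖u n z‖ ≤ (‖l‖ ^ (n + 1))⁻¹ * (C' * (q ^ n * ‖z‖) ^ 2) := by
      simp only [u, norm_mul, norm_inv, norm_pow]
      gcongr
      exact h1.trans (by gcongr)
    refine h3.trans (le_of_eq ?_)
    rw [div_pow, pow_succ]
    field_simp
    ring
  have hr1 : q ^ 2 / ‖l‖ < 1 := (div_lt_one hpos).mpr hqq
  have hr0 : 0 ≤ q ^ 2 / ‖l‖ := by positivity
  have hgeo := summable_geometric_of_lt_one hr0 hr1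
  have hsum : ∀ z ∈ ball (0 : ℂ) ρ, Summable fun n => u n z := fun z hz =>
    Summable.of_norm_bounded (hgeo.mul_left _) (fun n => hu n z hz)
  have hud : DifferentiableOn ℂ (fun z => ∑' n, u n z) (ball 0 ρ) := by
    refine Complex.differentiableOn_tsum_of_summable_norm
      (u := fun n => (C' / ‖l‖ * ρ ^ 2) * (q ^ 2 / ‖l‖) ^ n) (hgeo.mul_left _) ?_ isOpen_ball ?_
    · intro n
      exact (((hg.mono hsub).comp (hitd n) (hit n)).sub ((hitd n).const_mul l)).const_mul _
    · intro n z hz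
      refine (hu n z hz).trans ?_
      have := (mem_ball_zero_iff.mp hz).le
      gcongr
  refine ⟨ρ, hρ0, hsub, fun z => z + ∑' n, u n z, differentiableOn_id.add hud, ?_, ?_, ?_⟩
  · have : ∀ n, u n 0 = 0 := by
      intro n
      have := hu n 0 (mem_ball_self hρ0)
      simpa using this
    simp [this]
  · have hb : ∀ z ∈ ball (0 : ℂ) ρ,
        ‖∑' n, u n z‖ ≤ (C' / ‖l‖ * (1 - q ^ 2 / ‖l‖)⁻¹) * ‖z‖ ^ 2 := by
      intro z hz
      refine tsum_of_norm_bounded (g := fun n => (C' / ‖l‖ * ‖z‖ ^ 2) * (q ^ 2 / ‖l‖) ^ n) ?_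
        (fun n => hu n z hz)
      rw [mul_right_comm]
      exact (hasSum_geometric_of_lt_one hr0 hr1).mul_left (C' / ‖l‖ * ‖z‖ ^ 2)
    have hO : (fun z : ℂ => ∑' n, u n z) =O[𝓝 0] fun z => ‖z - 0‖ ^ 2 := by
      refine Asymptotics.IsBigO.of_bound
        (C' / ‖l‖ * (1 - q ^ 2 / ‖l‖)⁻¹) ?_
      filter_upwards [ball_mem_nhds (0 : ℂ) hρ0] with z hz
      simpa using hb z hz
    have h1 : HasDerivAt (fun z : ℂ => ∑' n, u n z) 0 0 := by
      have := hO.hasFDerivAt (𝕜 := ℂ) (by norm_num : 1 < 2)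
      simpa using this.hasDerivAt
    simpa using ((hasDerivAt_id' (0 : ℂ)).fun_add h1).deriv
  · intro z hz
    have h1 : ∀ n, u n (g z) = l * u (n + 1) z := by
      intro n
      simp only [u, Function.iterate_succ_apply]
      rw [pow_succ l (n + 1)]
      field_simp
    have h2 := (hsum z hz).tsum_eq_zero_add
    simp only [h1, tsum_mul_left]
    rw [h2]
    simp only [u, Function.iterate_zero, id]
    field_simp
    ring

/-- Near an attracting fixed point `b` of `G` there is an inverse Koenigs coordinate: a
biholomorphic parametrization `e` by a disc in which `G` acts as multiplication by `G'(b)`. -/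
theorem exists_koenigs_parametrization {G : ℂ → ℂ} {D V : Set ℂ} {b : ℂ} (hD : IsOpen D)
    (hG : DifferentiableOn ℂ G D) (hb : IsAttractingFixedPoint D G b) (hV : V ∈ 𝓝 b) :
    ∃ (e : OpenPartialHomeomorph ℂ ℂ) (R : ℝ), 0 < R ∧ e.source = ball 0 R ∧ e 0 = b ∧
      e.target ⊆ D ∩ V ∧ DifferentiableOn ℂ e (ball 0 R) ∧
      DifferentiableOn ℂ e.symm e.target ∧ deriv e 0 ≠ 0 ∧
      ∀ z ∈ ball (0 : ℂ) R, e (deriv G b * z) = G (e z) := by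
  obtain ⟨hbD, hGb, hpos, hlt⟩ := hb
  have hVD : D ∩ V ∈ 𝓝 b := inter_mem (hD.mem_nhds hbD) hV
  obtain ⟨V', hV'sub, hV'o, hbV'⟩ := _root_.mem_nhds_iff.mp hVD
  let g : ℂ → ℂ := fun z => G (z + b) - b
  have hOo : IsOpen ((fun z : ℂ => z + b) ⁻¹' V') := hV'o.preimage (by fun_prop)
  have hdg : deriv g 0 = deriv G b := by
    simp only [g, deriv_sub_const_fun]
    rw [deriv_comp_add_const]; simp
  have hgd : DifferentiableOn ℂ g ((fun z : ℂ => z + b) ⁻¹' V') := by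
    refine DifferentiableOn.sub_const ?_ _
    exact hG.comp (by fun_prop) (fun z hz => (hV'sub hz).1)
  obtain ⟨ρ, hρ, hsub, φ, hφd, hφ0, hφ1, hφ⟩ := exists_koenigs_linearization hOo
    (by simpa using hbV') hgd (by simp [g, hGb]) (by rwa [hdg]) (by rwa [hdg])
  rw [hdg] at hφ
  obtain ⟨e, he, h0, hsrc, hsymm⟩ := exists_biholomorphic_openPartialHomeomorph
    (h := fun z => φ (z - b)) (O := (fun z : ℂ => z - b) ⁻¹' ball 0 ρ) (p := b)
    (isOpen_ball.preimage (by fun_prop)) (hφd.comp (by fun_prop) (fun z hz => hz))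
    (by simpa using hρ) (by
      have := deriv_comp_sub_const φ b b
      rw [this]; simp [hφ1])
  have heb : e b = 0 := by rw [he]; simpa using hφ0
  have h0t : (0 : ℂ) ∈ e.target := heb ▸ e.map_source h0
  have hsb : e.symm 0 = b := by rw [← heb, e.left_inv h0]
  -- the points whose `G`-image stays in the domain of injectivity of the linearizing function
  have hev : ∀ᶠ z in 𝓝 (0 : ℂ), z ∈ e.target ∧ deriv G b * z ∈ e.target ∧
      G (e.symm z) ∈ e.source := by
    have hc1 : Tendsto (fun z : ℂ => deriv G b * z) (𝓝 0) (𝓝 0) := by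
      simpa using (continuous_const_mul (deriv G b)).tendsto (0 : ℂ)
    have hc2 : Tendsto (fun z => G (e.symm z)) (𝓝 0) (𝓝 b) := by
      have h1 : Tendsto e.symm (𝓝 0) (𝓝 b) := by
        have := (e.continuousAt_symm h0t).tendsto
        rwa [hsb] at this
      have h2 := (hG.differentiableAt (hD.mem_nhds hbD)).continuousAt.tendsto
      rw [hGb] at h2
      exact h2.comp h1
    filter_upwards [e.open_target.mem_nhds h0t, hc1 (e.open_target.mem_nhds h0t),
      hc2 (e.open_source.mem_nhds h0)] with z h1 h2 h3 using ⟨h1, h2, h3⟩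
  obtain ⟨R, hR, hRb⟩ := Metric.eventually_nhds_iff_ball.mp hev
  let e' := e.symm.restrOpen (ball 0 R) isOpen_ball
  have hsrc' : e'.source = ball 0 R := by
    change e.symm.source ∩ ball 0 R = _
    exact inter_eq_right.mpr fun z hz => (hRb z hz).1
  have hcoe : (e' : ℂ → ℂ) = e.symm := rfl
  have htgt : ∀ x ∈ e'.target, x ∈ e.source := by
    intro x hx
    have h1 : e'.symm x ∈ ball 0 R := hsrc' ▸ e'.map_target hx
    have h2 : e.symm (e'.symm x) = x := e'.right_inv hx
    rw [← h2]
    exact e.map_target (hRb _ h1).1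
  refine ⟨e', R, hR, hsrc', hsb, ?_, ?_, ?_, ?_, ?_⟩
  · exact fun x hx => hV'sub (by simpa using hsub (hsrc (htgt x hx)))
  · rw [hcoe]; exact hsymm.mono fun z hz => (hRb z hz).1
  · change DifferentiableOn ℂ e e'.target
    rw [he]
    exact hφd.comp (by fun_prop) fun x hx => hsrc (htgt x hx)
  · rw [hcoe]
    intro hzero
    have hd1 : HasDerivAt e.symm 0 (e b) := by
      have := (hsymm.differentiableAt (e.open_target.mem_nhds h0t)).hasDerivAt
      rw [hzero] at this
      rwa [heb]
    have hd2 : HasDerivAt e (deriv e b) b := by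
      rw [he]
      refine (DifferentiableAt.hasDerivAt ?_)
      have : DifferentiableAt ℂ φ (b - b) := hφd.differentiableAt
        (isOpen_ball.mem_nhds (by simpa using hρ))
      exact DifferentiableAt.fun_comp' (f := fun z => z - b) b this (by fun_prop)
    have h3 := hd1.comp b hd2
    have h4 : (e.symm ∘ e) =ᶠ[𝓝 b] id := by
      filter_upwards [e.open_source.mem_nhds h0] with x hx using e.left_inv hx
    have h5 := (h3.congr_of_eventuallyEq h4.symm).unique (hasDerivAt_id b)
    simp at h5
  · intro z hz
    obtain ⟨h1, h2, h3⟩ := hRb z hz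
    rw [hcoe]
    have h4 : e (G (e.symm z)) = deriv G b * z := by
      have h5 := hφ (e.symm z - b) (hsrc (e.map_target h1))
      have h6 := e.right_inv h1
      rw [he] at h6 ⊢
      simp only [g, sub_add_cancel] at h5
      exact h5.trans (congrArg _ h6)
    rw [← h4, e.left_inv h3]

/-! ### Infinitesimal symmetries by rescaling -/

/-- `v` is an infinitesimal symmetry of the set `A` on `O`: there are holomorphic maps
`g = id + ε (v + o(1))` on `O`, with `ε > 0` arbitrarily small, which preserve both `A` and its
complement, the error being uniform on `O`. -/
def IsInfinitesimalSymmetry (A O : Set ℂ) (v : ℂ → ℂ) : Prop :=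
  ∀ δ > 0, ∃ ε : ℝ, 0 < ε ∧ ε < δ ∧ ∃ g : ℂ → ℂ, DifferentiableOn ℂ g O ∧
    ∀ z ∈ O, (z ∈ A ↔ g z ∈ A) ∧ ‖g z - z - ε * v z‖ ≤ δ * ε

lemma eventually_norm_comp_pow_mul_sub_le {w g : ℂ → ℂ} {n : ℕ} {r δ : ℝ} {l : ℂ}
    (hg : ContinuousAt g 0) (hg0 : g 0 ≠ 0) (hw : ∀ᶠ z in 𝓝 0, w z = z ^ n * g z)
    (hl : ‖l‖ < 1) (hr : r ≤ 1) (hδ : 0 < δ) :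
    ∀ᶠ k : ℕ in atTop, ∀ z ∈ ball (0 : ℂ) r,
      ‖w (l ^ k * z) - (l ^ k * z) ^ n * g 0‖ ≤ δ * ‖(l ^ k) ^ n * g 0‖ := by
  have h1 : ∀ᶠ z in 𝓝 (0 : ℂ), w z = z ^ n * g z ∧ dist (g z) (g 0) < δ * ‖g 0‖ :=
    hw.and (Metric.tendsto_nhds.mp hg _ (by positivity))
  obtain ⟨τ, hτ, hb⟩ := Metric.eventually_nhds_iff_ball.mp h1
  have h2 := (tendsto_pow_atTop_nhds_zero_of_lt_one (norm_nonneg l) hl).eventually_lt_const hτ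
  filter_upwards [h2] with k hk z hz
  have hz1 : ‖z‖ ≤ 1 := (mem_ball_zero_iff.mp hz).le.trans hr
  have hmem : l ^ k * z ∈ ball (0 : ℂ) τ := by
    rw [mem_ball_zero_iff, norm_mul, norm_pow]
    nlinarith [norm_nonneg z, pow_nonneg (norm_nonneg l) k]
  obtain ⟨h3, h4⟩ := hb _ hmem
  rw [h3, ← mul_sub, mul_pow, norm_mul, norm_mul, norm_mul]
  rw [dist_eq_norm] at h4
  have h5 : ‖z ^ n‖ ≤ 1 := by rw [norm_pow]; exact pow_le_one₀ (norm_nonneg _) hz1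
  calc ‖(l ^ k) ^ n‖ * ‖z ^ n‖ * ‖g (l ^ k * z) - g 0‖
      ≤ ‖(l ^ k) ^ n‖ * 1 * (δ * ‖g 0‖) := by gcongr
    _ = δ * (‖(l ^ k) ^ n‖ * ‖g 0‖) := by ring

/-- Rescaling a family of small perturbations `w` by the powers of a contraction `z ↦ l z`
produces arbitrarily small perturbations dominated by a single monomial `a zᵐ` on the whole disc.
If some `w` vanishes at `0` to order at least two, its own rescalings do. If all small `w` vanish
to order one, rescaling preserves the coefficient `w'(0)`, which is small. Otherwise the constant
term `w(0)` is blown up to a size between `‖w‖_∞` and `1`. -/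
theorem exists_rescaling_near_monomial {𝓦 : Set (ℂ → ℂ)} {r : ℝ} {l : ℂ} (hr0 : 0 < r)
    (hr : r ≤ 1) (hl0 : l ≠ 0) (hl : ‖l‖ < 1)
    (hd : ∀ w ∈ 𝓦, DifferentiableOn ℂ w (ball 0 r)) (hne : ∀ w ∈ 𝓦, ¬ ∀ᶠ z in 𝓝 0, w z = 0)
    (hsmall : ∀ η > 0, ∃ w ∈ 𝓦, ∀ z ∈ ball (0 : ℂ) r, ‖w z‖ ≤ η) :
    ∃ m : ℕ, ∀ δ > 0, ∃ w ∈ 𝓦, ∃ (k : ℕ) (a : ℂ), a ≠ 0 ∧ ‖a‖ < δ ∧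
      ∀ z ∈ ball (0 : ℂ) r, ‖(l ^ k)⁻¹ * w (l ^ k * z) - a * z ^ m‖ ≤ δ * ‖a‖ := by
  have hlp : 0 < ‖l‖ := norm_pos_iff.mpr hl0
  have hfac : ∀ w ∈ 𝓦, ∃ (n : ℕ) (g : ℂ → ℂ), AnalyticAt ℂ g 0 ∧ g 0 ≠ 0 ∧
      ∀ᶠ z in 𝓝 0, w z = z ^ n * g z := by
    intro w hw
    have han : AnalyticAt ℂ w 0 := (hd w hw).analyticAt (ball_mem_nhds 0 hr0)
    simpa using han.exists_eventuallyEq_pow_smul_nonzero_iff.mpr (hne w hw)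
  -- the rescaling of a perturbation that vanishes at the origin
  have hresc : ∀ (w g : ℂ → ℂ) (m : ℕ), AnalyticAt ℂ g 0 → g 0 ≠ 0 →
      (∀ᶠ z in 𝓝 0, w z = z ^ (m + 1) * g z) → ∀ δ > 0, ∀ᶠ k : ℕ in atTop,
      ∀ z ∈ ball (0 : ℂ) r, ‖(l ^ k)⁻¹ * w (l ^ k * z) - (l ^ k) ^ m * g 0 * z ^ (m + 1)‖
        ≤ δ * ‖(l ^ k) ^ m * g 0‖ := by
    intro w g m hg hg0 hwg δ hδ
    filter_upwards [eventually_norm_comp_pow_mul_sub_le hg.continuousAt hg0 hwg hl hr hδ]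
      with k hk z hz
    have hlk : l ^ k ≠ 0 := pow_ne_zero _ hl0
    have h1 : (l ^ k)⁻¹ * w (l ^ k * z) - (l ^ k) ^ m * g 0 * z ^ (m + 1) =
        (l ^ k)⁻¹ * (w (l ^ k * z) - (l ^ k * z) ^ (m + 1) * g 0) := by
      rw [mul_sub, mul_pow]; congr 1; field_simp; ring
    have h2 : δ * ‖(l ^ k) ^ m * g 0‖ = ‖(l ^ k)⁻¹‖ * (δ * ‖(l ^ k) ^ (m + 1) * g 0‖) := by
      simp only [norm_mul, norm_inv, pow_succ]
      have : ‖l ^ k‖ ≠ 0 := norm_ne_zero_iff.mpr hlk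
      field_simp
    rw [h1, h2, norm_mul]
    gcongr
    exact hk z hz
  by_cases hA : ∃ w ∈ 𝓦, ∃ (m : ℕ) (g : ℂ → ℂ), AnalyticAt ℂ g 0 ∧ g 0 ≠ 0 ∧
      ∀ᶠ z in 𝓝 0, w z = z ^ (m + 2) * g z
  · obtain ⟨w, hw, m, g, hg, hg0, hwg⟩ := hA
    refine ⟨m + 2, fun δ hδ => ⟨w, hw, ?_⟩⟩
    have hlim : Tendsto (fun k : ℕ => ‖(l ^ k) ^ (m + 1) * g 0‖) atTop (𝓝 0) := by
      have h1 : Tendsto (fun k : ℕ => l ^ k) atTop (𝓝 0) :=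
        tendsto_pow_atTop_nhds_zero_of_norm_lt_one hl
      simpa using ((h1.pow (m + 1)).mul_const (g 0)).norm
    obtain ⟨k, hk1, hk2⟩ := ((hresc w g (m + 1) hg hg0 hwg δ hδ).and
      (hlim.eventually_lt_const hδ)).exists
    exact ⟨k, (l ^ k) ^ (m + 1) * g 0,
      mul_ne_zero (pow_ne_zero _ (pow_ne_zero _ hl0)) hg0, hk2, hk1⟩
  by_cases hB : ∀ η > 0, ∃ w ∈ 𝓦, (∀ z ∈ ball (0 : ℂ) r, ‖w z‖ ≤ η) ∧ w 0 ≠ 0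
  · refine ⟨0, fun δ hδ => ?_⟩
    -- the first rescaled constant term of size at least `4 η / δ'` has size below
    -- `4 η / (δ' ‖l‖) < δ'`, as `k` is minimal
    obtain ⟨δ', hδ'0, hδ'δ, hδ'1⟩ : ∃ δ' : ℝ, 0 < δ' ∧ δ' ≤ δ ∧ δ' ≤ 1 :=
      ⟨min δ 1, by positivity, min_le_left _ _, min_le_right _ _⟩
    set η := δ' ^ 2 * ‖l‖ / 8 with hη
    have hη0 : 0 < η := by positivity
    obtain ⟨w, hw, hwη, hw0⟩ := hB η hη0
    have hw0η : ‖w 0‖ ≤ η := hwη 0 (mem_ball_self hr0)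
    have hex : ∃ k : ℕ, 4 * η / δ' ≤ ‖w 0‖ * ‖l‖⁻¹ ^ k := by
      have h1 : Tendsto (fun k : ℕ => ‖w 0‖ * ‖l‖⁻¹ ^ k) atTop atTop :=
        (tendsto_pow_atTop_atTop_of_one_lt ((one_lt_inv₀ hlp).mpr hl)).const_mul_atTop
          (norm_pos_iff.mpr hw0)
      exact (h1.eventually_ge_atTop _).exists
    obtain ⟨k, hk, hkmin⟩ : ∃ k : ℕ, 4 * η / δ' ≤ ‖w 0‖ * ‖l‖⁻¹ ^ k ∧
        ∀ j < k, ‖w 0‖ * ‖l‖⁻¹ ^ j < 4 * η / δ' := by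
      classical
      exact ⟨Nat.find hex, Nat.find_spec hex, fun j hj => not_le.mp (Nat.find_min hex hj)⟩
    have h4η : η < 4 * η / δ' := by
      rw [lt_div_iff₀ hδ'0]; nlinarith
    have hupper : ‖w 0‖ * ‖l‖⁻¹ ^ k < δ' := by
      cases k with
      | zero => simp at hk; linarith
      | succ j =>
        have h1 := hkmin j j.lt_succ_self
        have h2 : 4 * η / δ' = δ' * ‖l‖ / 2 := by rw [hη]; field_simp; norm_num
        rw [h2] at h1
        rw [pow_succ, ← mul_assoc, ← div_eq_mul_inv, div_lt_iff₀ hlp]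
        nlinarith
    have hnorm : ‖(l ^ k)⁻¹ * w 0‖ = ‖w 0‖ * ‖l‖⁻¹ ^ k := by
      rw [norm_mul, norm_inv, norm_pow, inv_pow, mul_comm]
    refine ⟨w, hw, k, (l ^ k)⁻¹ * w 0, mul_ne_zero (inv_ne_zero (pow_ne_zero _ hl0)) hw0,
      by rw [hnorm]; linarith, fun z hz => ?_⟩
    have hlk1 : ‖l ^ k‖ ≤ 1 := by rw [norm_pow]; exact pow_le_one₀ hlp.le hl.le
    have hlk0 : 0 < ‖l ^ k‖ := norm_pos_iff.mpr (pow_ne_zero _ hl0)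
    have hzr : ‖z‖ < r := mem_ball_zero_iff.mp hz
    have hz' : l ^ k * z ∈ ball (0 : ℂ) r := by
      rw [mem_ball_zero_iff, norm_mul]; nlinarith [norm_nonneg z]
    -- the Schwarz lemma bounds the non-constant part of the rescaled perturbation
    have hmaps : MapsTo w (ball 0 r) (closedBall (w 0) (2 * η)) := by
      intro y hy
      rw [mem_closedBall, dist_eq_norm]
      exact (norm_sub_le _ _).trans (by linarith [hwη y hy])
    have hsch : ‖w (l ^ k * z) - w 0‖ ≤ 2 * η / r * ‖l ^ k * z‖ := by
      simpa [dist_eq_norm] using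
        Complex.dist_le_div_mul_dist_of_mapsTo_ball (hd w hw) hmaps hz'
    have h5 : ‖(l ^ k)⁻¹ * w (l ^ k * z) - (l ^ k)⁻¹ * w 0 * z ^ 0‖ ≤ 2 * η := by
      rw [pow_zero, mul_one, ← mul_sub, norm_mul, norm_inv]
      rw [inv_mul_le_iff₀ hlk0]
      refine hsch.trans ?_
      rw [norm_mul, div_mul_eq_mul_div, div_le_iff₀ hr0]
      have : ‖l ^ k‖ * ‖z‖ ≤ ‖l ^ k‖ * r := by gcongr
      nlinarith
    rw [hnorm]
    refine h5.trans ?_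
    have h6 : 4 * η ≤ δ' * (‖w 0‖ * ‖l‖⁻¹ ^ k) := by
      rw [div_le_iff₀ hδ'0] at hk; linarith
    have h7 : δ' * (‖w 0‖ * ‖l‖⁻¹ ^ k) ≤ δ * (‖w 0‖ * ‖l‖⁻¹ ^ k) := by gcongr
    linarith
  · push Not at hB
    obtain ⟨η₀, hη₀, hB⟩ := hB
    refine ⟨1, fun δ hδ => ?_⟩
    obtain ⟨w, hw, hwη⟩ := hsmall (min η₀ (r / 2 * δ / 2)) (by positivity)
    have hw0 : w 0 = 0 := hB w hw fun z hz => (hwη z hz).trans (min_le_left _ _)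
    obtain ⟨n, g, hg, hg0, hwg⟩ := hfac w hw
    have hn : n = 1 := by
      match n, hwg with
      | 0, hwg =>
        have := hwg.self_of_nhds
        simp [hw0] at this
        exact absurd this.symm hg0
      | 1, _ => rfl
      | m + 2, hwg => exact absurd ⟨w, hw, m, g, hg, hg0, hwg⟩ hA
    subst hn
    have hder : deriv w 0 = g 0 := by
      have h1 : HasDerivAt (fun z => z ^ 1 * g z) (g 0) 0 := by
        simpa using (hasDerivAt_id' (0 : ℂ)).fun_mul hg.differentiableAt.hasDerivAt
      exact (h1.congr_of_eventuallyEq hwg).deriv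
    have hbound : ‖g 0‖ ≤ δ / 2 := by
      rw [← hder]
      have hsub : closedBall (0 : ℂ) (r / 2) ⊆ ball 0 r := closedBall_subset_ball (by linarith)
      have h1 := Complex.norm_deriv_le_of_forall_mem_sphere_norm_le (c := 0) (R := r / 2)
        (C := r / 2 * δ / 2) (f := w) (by positivity)
        (((hd w hw).mono hsub).diffContOnCl_ball subset_rfl)
        (fun z hz => (hwη z (hsub (sphere_subset_closedBall hz))).trans (min_le_right _ _))
      refine h1.trans (le_of_eq ?_)
      field_simp
    obtain ⟨k, hk⟩ := (hresc w g 0 hg hg0 (by simpa using hwg) δ hδ).exists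
    refine ⟨w, hw, k, g 0, hg0, by linarith, fun z hz => ?_⟩
    simpa using hk z hz

/-- A set that is invariant under a linear contraction near `0` and has symmetries converging to
the identity there, none of them the identity, has a monomial vector field `c zᵐ` as an
infinitesimal symmetry. -/
theorem exists_isInfinitesimalSymmetry_monomial {A : Set ℂ} {𝓕 : Set (ℂ → ℂ)} {r R : ℝ} {l : ℂ}
    (hr0 : 0 < r) (hr : r ≤ 1) (hrR : r < R) (hl0 : l ≠ 0) (hl : ‖l‖ < 1)
    (hA : ∀ z ∈ ball (0 : ℂ) R, (z ∈ A ↔ l * z ∈ A))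
    (hd : ∀ f ∈ 𝓕, DifferentiableOn ℂ f (ball 0 r)) (hne : ∀ f ∈ 𝓕, ¬ ∀ᶠ z in 𝓝 0, f z = z)
    (hsym : ∀ f ∈ 𝓕, ∀ z ∈ ball (0 : ℂ) r, (z ∈ A ↔ f z ∈ A))
    (hsmall : ∀ η > 0, ∃ f ∈ 𝓕, ∀ z ∈ ball (0 : ℂ) r, ‖f z - z‖ ≤ η) :
    ∃ (c : ℂ) (m : ℕ), ‖c‖ = 1 ∧ IsInfinitesimalSymmetry A (ball 0 r) (fun z => c * z ^ m) := by
  obtain ⟨m, hm⟩ := exists_rescaling_near_monomial (𝓦 := (fun f z => f z - z) '' 𝓕) hr0 hr hl0 hl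
    (by rintro _ ⟨f, hf, rfl⟩; exact (hd f hf).sub differentiableOn_id)
    (by rintro _ ⟨f, hf, rfl⟩; simpa [sub_eq_zero] using hne f hf)
    (by
      intro η hη
      obtain ⟨f, hf, h⟩ := hsmall η hη
      exact ⟨_, ⟨f, hf, rfl⟩, h⟩)
  have hApow : ∀ k : ℕ, ∀ z ∈ ball (0 : ℂ) R, (z ∈ A ↔ l ^ k * z ∈ A) := by
    intro k z hz
    induction k with
    | zero => simp
    | succ k ih =>
      rw [ih, hA (l ^ k * z), pow_succ', mul_assoc]
      rw [mem_ball_zero_iff] at hz ⊢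
      rw [norm_mul, norm_pow]
      have : ‖l‖ ^ k ≤ 1 := pow_le_one₀ (norm_nonneg _) hl.le
      nlinarith [norm_nonneg z]
  choose w hw k a ha0 haδ hwa using fun n : ℕ => hm (1 / ((n : ℝ) + 1)) (by positivity)
  choose f hf hfw using hw
  -- the directions `a / ‖a‖` of the monomials accumulate somewhere on the unit circle
  obtain ⟨c, hc, φ, hφ, hlim⟩ := (isCompact_sphere (0 : ℂ) 1).tendsto_subseq
    (x := fun n => a n / (‖a n‖ : ℂ)) (fun n => by
      simp [norm_ne_zero_iff.mpr (ha0 n)])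
  refine ⟨c, m, by simpa using hc, fun δ hδ => ?_⟩
  set δ' := min (min (δ / 2) ((R - r) / 3)) 1 with hδ'
  have hδ'0 : 0 < δ' := by
    have : 0 < R - r := by linarith
    positivity
  have h1 : ∀ᶠ n in atTop, 1 / ((φ n : ℝ) + 1) < δ' :=
    (tendsto_one_div_add_atTop_nhds_zero_nat.comp hφ.tendsto_atTop).eventually_lt_const hδ'0
  have h2 := Metric.tendsto_nhds.mp hlim δ' hδ'0
  obtain ⟨n, hn1, hn2⟩ := (h1.and h2).exists
  set N := φ n with hN
  have haN : 0 < ‖a N‖ := norm_pos_iff.mpr (ha0 N)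
  have haN' : ‖a N‖ < δ' := (haδ N).trans hn1
  have hδ1 : δ' ≤ 1 := min_le_right _ _
  have hδ2 : δ' ≤ δ / 2 := (min_le_left _ _).trans (min_le_left _ _)
  have hδ3 : δ' ≤ (R - r) / 3 := (min_le_left _ _).trans (min_le_right _ _)
  have hlk : l ^ k N ≠ 0 := pow_ne_zero _ hl0
  have hlk1 : ‖l ^ k N‖ ≤ 1 := by rw [norm_pow]; exact pow_le_one₀ (norm_nonneg _) hl.le
  have hmem : ∀ z ∈ ball (0 : ℂ) r, l ^ k N * z ∈ ball (0 : ℂ) r := by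
    intro z hz
    rw [mem_ball_zero_iff] at hz ⊢
    rw [norm_mul]; nlinarith [norm_nonneg z]
  have hzm : ∀ z ∈ ball (0 : ℂ) r, ‖z ^ m‖ ≤ 1 := by
    intro z hz
    rw [norm_pow]
    exact pow_le_one₀ (norm_nonneg _) ((mem_ball_zero_iff.mp hz).le.trans hr)
  have hg : ∀ z, (l ^ k N)⁻¹ * f N (l ^ k N * z) - z = (l ^ k N)⁻¹ * w N (l ^ k N * z) := by
    intro z
    rw [← hfw N]
    field_simp
  have herr : ∀ z ∈ ball (0 : ℂ) r,
      ‖(l ^ k N)⁻¹ * w N (l ^ k N * z) - a N * z ^ m‖ ≤ δ' * ‖a N‖ := fun z hz =>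
    (hwa N z hz).trans (by gcongr)
  refine ⟨‖a N‖, haN, by linarith, fun z => (l ^ k N)⁻¹ * f N (l ^ k N * z), ?_, fun z hz => ?_⟩
  · exact ((hd _ (hf N)).comp (by fun_prop) hmem).const_mul _
  · constructor
    · have hzR : z ∈ ball (0 : ℂ) R := ball_subset_ball hrR.le hz
      have hgR : (l ^ k N)⁻¹ * f N (l ^ k N * z) ∈ ball (0 : ℂ) R := by
        rw [mem_ball_zero_iff] at hz ⊢
        have h3 := herr z (mem_ball_zero_iff.mpr hz)
        have h4 : ‖a N * z ^ m‖ ≤ ‖a N‖ := by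
          rw [norm_mul]; nlinarith [hzm z (mem_ball_zero_iff.mpr hz)]
        have h5 : ‖(l ^ k N)⁻¹ * w N (l ^ k N * z)‖ ≤ δ' * ‖a N‖ + ‖a N‖ := by
          have := norm_add_le ((l ^ k N)⁻¹ * w N (l ^ k N * z) - a N * z ^ m) (a N * z ^ m)
          rw [sub_add_cancel] at this
          linarith
        have h6 : ‖(l ^ k N)⁻¹ * f N (l ^ k N * z)‖ ≤
            ‖(l ^ k N)⁻¹ * w N (l ^ k N * z)‖ + ‖z‖ := by
          rw [← hg]
          simpa using norm_add_le ((l ^ k N)⁻¹ * f N (l ^ k N * z) - z) z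
        nlinarith
      rw [hApow (k N) z hzR, hsym _ (hf N) _ (hmem z hz), hApow (k N) _ hgR,
        mul_inv_cancel_left₀ hlk]
    · rw [hg]
      have h3 : (a N - ‖a N‖ * c) * z ^ m = ‖a N‖ * (a N / ‖a N‖ - c) * z ^ m := by
        have : (‖a N‖ : ℂ) ≠ 0 := by exact_mod_cast haN.ne'
        field_simp
      have h4 : ‖(a N - ‖a N‖ * c) * z ^ m‖ ≤ ‖a N‖ * δ' := by
        rw [h3, norm_mul, norm_mul, Complex.norm_real, norm_norm]
        rw [dist_eq_norm] at hn2
        have := hzm z hz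
        calc _ ≤ ‖a N‖ * δ' * 1 := by
              gcongr
              exact hn2.le
          _ = _ := mul_one _
      have h5 : (l ^ k N)⁻¹ * w N (l ^ k N * z) - ‖a N‖ * (c * z ^ m) =
          ((l ^ k N)⁻¹ * w N (l ^ k N * z) - a N * z ^ m) + (a N - ‖a N‖ * c) * z ^ m := by ring
      rw [h5]
      refine (norm_add_le _ _).trans ?_
      nlinarith [herr z hz]

/-! ### Rectification of an infinitesimal symmetry -/

/-- If from each point of `B` near the segment from `x` to `x + t d` one can move inside `B` by
`ε d` up to an error `o(ε)`, with `ε` arbitrarily small, then `x + t d` is in the closure of `B`: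
after `⌊t / ε⌋` moves the accumulated error is still `o(1)`. -/
lemma add_smul_mem_closure_of_approx_steps {B : Set ℂ} {x d : ℂ} {t ρ : ℝ} (ht : 0 ≤ t)
    (hρ : 0 < ρ) (hd : ‖d‖ = 1) (hx : x ∈ B)
    (hstep : ∀ δ > 0, ∃ ε : ℝ, 0 < ε ∧ ε < δ ∧ ∀ y ∈ B,
      (∃ u ∈ Icc 0 t, ‖y - (x + u * d)‖ < ρ) → ∃ y' ∈ B, ‖y' - (y + ε * d)‖ ≤ δ * ε) :
    x + t * d ∈ closure B := by
  rw [Metric.mem_closure_iff]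
  intro τ hτ
  set δ := min ρ τ / (2 * (t + 1)) with hδdef
  have hm : 0 < min ρ τ := lt_min hρ hτ
  have hδ : 0 < δ := by positivity
  have hδt : δ * (t + 1) = min ρ τ / 2 := by rw [hδdef]; field_simp
  obtain ⟨ε, hε, hεδ, hs⟩ := hstep δ hδ
  have hiter : ∀ j : ℕ, j * ε ≤ t → ∃ y ∈ B, ‖y - (x + (j * ε : ℝ) * d)‖ ≤ δ * (j * ε) := by
    intro j
    induction j with
    | zero => exact fun _ => ⟨x, hx, by simp⟩
    | succ j ih =>
      intro hj
      push_cast at hj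
      have hj' : j * ε ≤ t := by nlinarith
      obtain ⟨y, hy, hyx⟩ := ih hj'
      have hj0 : 0 ≤ j * ε := by positivity
      obtain ⟨y', hy', hy'y⟩ := hs y hy ⟨j * ε, ⟨hj0, hj'⟩, by
        refine hyx.trans_lt ?_
        have := min_le_left ρ τ
        nlinarith⟩
      refine ⟨y', hy', ?_⟩
      have h1 : y' - (x + (((j + 1 : ℕ) * ε : ℝ) : ℂ) * d) =
          (y' - (y + ε * d)) + (y - (x + (j * ε : ℝ) * d)) := by push_cast; ring
      rw [h1]
      refine (norm_add_le _ _).trans ?_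
      have h2 : δ * ((j + 1 : ℕ) * ε) = δ * ε + δ * (j * ε) := by push_cast; ring
      rw [h2]
      exact add_le_add hy'y hyx
  have hfl : (⌊t / ε⌋₊ : ℝ) ≤ t / ε := Nat.floor_le (by positivity)
  have hfl' : t / ε < ⌊t / ε⌋₊ + 1 := Nat.lt_floor_add_one _
  rw [le_div_iff₀ hε] at hfl
  rw [div_lt_iff₀ hε] at hfl'
  obtain ⟨y, hy, hyx⟩ := hiter _ hfl
  refine ⟨y, hy, ?_⟩
  rw [dist_comm, dist_eq_norm]
  have h1 : y - (x + t * d) = (y - (x + (⌊t / ε⌋₊ * ε : ℝ) * d)) +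
      ((⌊t / ε⌋₊ * ε - t : ℝ) : ℂ) * d := by push_cast; ring
  have h2 : ‖((⌊t / ε⌋₊ * ε - t : ℝ) : ℂ) * d‖ ≤ ε := by
    rw [norm_mul, hd, mul_one, Complex.norm_real, Real.norm_eq_abs, abs_le]
    constructor <;> linarith
  rw [h1]
  refine (norm_add_le _ _).trans_lt ?_
  have := min_le_right ρ τ
  nlinarith

/-- A holomorphic map moving points of `ball z (6 E)` by at most `E` takes the value `z`. -/
lemma exists_preimage_of_norm_sub_self_le {g : ℂ → ℂ} {z : ℂ} {E : ℝ} (hE : 0 < E)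
    (hg : DifferentiableOn ℂ g (ball z (6 * E))) (hgE : ∀ u ∈ ball z (6 * E), ‖g u - u‖ ≤ E) :
    ∃ u ∈ ball z (6 * E), g u = z := by
  have hsub : closedBall z (5 * E) ⊆ ball z (6 * E) := closedBall_subset_ball (by linarith)
  have hz : z ∈ ball z (6 * E) := mem_ball_self (by linarith)
  have hsph : ∀ u ∈ sphere z (5 * E), 3 * E ≤ ‖g u - g z‖ := by
    intro u hu
    have h1 := hgE u (hsub (sphere_subset_closedBall hu))
    have h2 := hgE z hz
    have h3 : ‖u - z‖ = 5 * E := by simpa [dist_eq_norm] using hu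
    have h4 : u - z = (g u - g z) - (g u - u) + (g z - z) := by ring
    have h5 := norm_add_le ((g u - g z) - (g u - u)) (g z - z)
    have h6 := norm_sub_le (g u - g z) (g u - u)
    rw [← h4, h3] at h5
    linarith
  have hfr : ∃ᶠ u in 𝓝 z, g u ≠ g z := by
    intro hev
    have hconst : EqOn g (fun _ => g z) (ball z (6 * E)) :=
      (hg.analyticOnNhd isOpen_ball).eqOn_of_preconnected_of_eventuallyEq analyticOnNhd_const
        (convex_ball _ _).isPreconnected hz (by simpa [Filter.EventuallyEq] using hev)
    have hu : z + ((5 * E : ℝ) : ℂ) ∈ sphere z (5 * E) := by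
      rw [mem_sphere, dist_eq_norm, add_sub_cancel_left, Complex.norm_real, Real.norm_eq_abs,
        abs_of_pos (by linarith)]
    have h1 := hsph _ hu
    rw [hconst (hsub (sphere_subset_closedBall hu))] at h1
    simp only [sub_self, norm_zero] at h1
    linarith
  have himg := (((hg.mono hsub).diffContOnCl_ball subset_rfl)).ball_subset_image_closedBall
    (by linarith) hsph hfr
  obtain ⟨u, hu, hgu⟩ := himg (show z ∈ ball (g z) (3 * E / 2) by
    rw [mem_ball, dist_comm, dist_eq_norm]
    linarith [hgE z hz])
  exact ⟨u, hsub hu, hgu⟩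

/-- On a disc where `ζ' = 1 / v`, a displacement by `ε (v + o(1))` changes `ζ` by
`ε (1 + o(1))`, uniformly. -/
lemma exists_norm_rectified_step_sub_le {v ζ : ℂ → ℂ} {p : ℂ} {κ M : ℝ} (hκ : 0 < κ)
    (hζ : ∀ z ∈ closedBall p (3 * κ), HasDerivAt ζ (v z)⁻¹ z)
    (hv : ContinuousOn v (closedBall p (3 * κ))) (hv0 : ∀ z ∈ closedBall p (3 * κ), v z ≠ 0)
    (hM1 : 1 ≤ M) (hvM : ∀ z ∈ closedBall p (3 * κ), ‖v z‖ ≤ M)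
    (hvM' : ∀ z ∈ closedBall p (3 * κ), ‖(v z)⁻¹‖ ≤ M) {δ : ℝ} (hδ : 0 < δ) :
    ∃ δ₁ > 0, δ₁ ≤ 1 ∧ ∀ ε : ℝ, 0 < ε → ε < δ₁ → ∀ z ∈ ball p (2 * κ), ∀ w,
      ‖w - z - ε * v z‖ ≤ δ₁ * ε → w ∈ ball p (3 * κ) ∧ ‖ζ w - ζ z - ε‖ ≤ δ * ε := by
  have huc : UniformContinuousOn (fun z => (v z)⁻¹) (closedBall p (3 * κ)) :=
    (isCompact_closedBall p (3 * κ)).uniformContinuousOn_of_continuous (hv.inv₀ hv0)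
  obtain ⟨τ, hτ, huc⟩ := Metric.uniformContinuousOn_iff.mp huc (δ / (2 * (M + 1)))
    (by positivity)
  set δ₁ := min (min 1 (δ / (2 * M))) (min κ τ / (M + 1)) with hδ₁
  have hδ₁0 : 0 < δ₁ := by positivity
  have ha : δ₁ ≤ 1 := (min_le_left _ _).trans (min_le_left _ _)
  have hb : M * δ₁ ≤ δ / 2 := by
    have h1 : δ₁ ≤ δ / (2 * M) := (min_le_left _ _).trans (min_le_right _ _)
    rw [le_div_iff₀ (by positivity)] at h1
    linarith
  have hc : δ₁ * (M + 1) ≤ min κ τ := by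
    have h1 : δ₁ ≤ min κ τ / (M + 1) := min_le_right _ _
    rwa [le_div_iff₀ (by positivity)] at h1
  refine ⟨δ₁, hδ₁0, ha, fun ε hε hεδ z hz w hw => ?_⟩
  have hz3 : z ∈ closedBall p (3 * κ) :=
    ball_subset_closedBall (ball_subset_ball (by linarith) hz)
  have hwz : ‖w - z‖ ≤ ε * (M + 1) := by
    have h1 := norm_add_le (w - z - ε * v z) (ε * v z)
    rw [sub_add_cancel, norm_mul, Complex.norm_real, Real.norm_eq_abs, abs_of_pos hε] at h1
    nlinarith [hvM z hz3]
  have hwz' : ‖w - z‖ < min κ τ := hwz.trans_lt (by nlinarith)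
  have hball : ∀ u ∈ closedBall z ‖w - z‖, u ∈ ball p (3 * κ) := by
    intro u hu
    rw [mem_closedBall] at hu
    rw [mem_ball] at hz ⊢
    linarith [dist_triangle u z p, min_le_left κ τ]
  have hwmem : w ∈ closedBall z ‖w - z‖ := by rw [mem_closedBall, dist_eq_norm]
  refine ⟨hball w hwmem, ?_⟩
  have hmv : ‖(ζ w - (v z)⁻¹ * w) - (ζ z - (v z)⁻¹ * z)‖ ≤ δ / (2 * (M + 1)) * ‖w - z‖ := by
    refine (convex_closedBall z ‖w - z‖).norm_image_sub_le_of_norm_hasDerivWithin_le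
      (f := fun u => ζ u - (v z)⁻¹ * u) (f' := fun u => (v u)⁻¹ - (v z)⁻¹) ?_ ?_
      (mem_closedBall_self (norm_nonneg _)) hwmem
    · intro u hu
      have h1 := (hζ u (ball_subset_closedBall (hball u hu))).fun_sub
        ((hasDerivAt_id' u).const_mul (v z)⁻¹)
      rw [mul_one] at h1
      exact h1.hasDerivWithinAt
    · intro u hu
      rw [← dist_eq_norm]
      exact (huc u (ball_subset_closedBall (hball u hu)) z hz3 (by
        rw [mem_closedBall] at hu
        exact hu.trans_lt (hwz'.trans_le (min_le_right _ _)))).le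
  have h2 : ζ w - ζ z - ε = ((ζ w - (v z)⁻¹ * w) - (ζ z - (v z)⁻¹ * z)) +
      (v z)⁻¹ * (w - z - ε * v z) := by
    have := hv0 z hz3
    field_simp
    ring
  rw [h2]
  refine (norm_add_le _ _).trans ?_
  rw [norm_mul]
  have h3 : ‖(v z)⁻¹‖ * ‖w - z - ε * v z‖ ≤ M * (δ₁ * ε) := by
    gcongr
    exact hvM' z hz3
  have h4 : δ / (2 * (M + 1)) * ‖w - z‖ ≤ δ / 2 * ε := by
    calc δ / (2 * (M + 1)) * ‖w - z‖ ≤ δ / (2 * (M + 1)) * (ε * (M + 1)) := by gcongr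
      _ = δ / 2 * ε := by field_simp
  nlinarith

/-- **Rectification.** Near a point of `A` at which an infinitesimal symmetry `v` does not vanish,
there is a biholomorphic parametrization `e` by a disc in which `A` is invariant under horizontal
translations. The inverse of `e` is a primitive `ζ` of `1 / v`: in that coordinate the nearby
symmetries of `A` are translations by `ε (1 + o(1))`. -/
theorem exists_rectifying_parametrization {A O : Set ℂ} {v : ℂ → ℂ} {p : ℂ} (hO : IsOpen O)
    (hv : DifferentiableOn ℂ v O) (hsymm : IsInfinitesimalSymmetry A O v) (hpO : p ∈ O)
    (hvp : v p ≠ 0) (hcl : ∀ x ∈ O, x ∉ A → ∀ᶠ u in 𝓝 x, u ∉ A) :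
    ∃ (e : OpenPartialHomeomorph ℂ ℂ) (s : ℝ), 0 < s ∧ e.source = ball 0 s ∧ e 0 = p ∧
      e.target ⊆ O ∧ DifferentiableOn ℂ e.symm e.target ∧
      ∀ x ∈ e.source, ∀ y ∈ e.source, x.im = y.im → e x ∈ A → e y ∈ A := by
  -- a primitive `ζ` of `1 / v` near `p`
  have hO' : IsOpen (O ∩ v ⁻¹' {0}ᶜ) :=
    hv.continuousOn.isOpen_inter_preimage hO isOpen_compl_singleton
  obtain ⟨ρ, hρ, hρO⟩ := Metric.isOpen_iff.mp hO' p ⟨hpO, hvp⟩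
  have hvd : DifferentiableOn ℂ (fun z => (v z)⁻¹) (ball p ρ) :=
    (hv.mono fun z hz => (hρO hz).1).inv fun z hz => (hρO hz).2
  obtain ⟨ζ, hζp, hζ⟩ := hvd.isExactOn_ball.with_val_at p 0
  obtain ⟨e, he, hpe, hsrc, -⟩ := exists_biholomorphic_openPartialHomeomorph
    (h := ζ) isOpen_ball (fun z hz => (hζ z hz).differentiableAt.differentiableWithinAt)
    (mem_ball_self hρ) (by rw [(hζ p (mem_ball_self hρ)).deriv]; exact inv_ne_zero hvp)
  have he0 : e p = 0 := by rw [he, hζp]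
  have h0t : (0 : ℂ) ∈ e.target := he0 ▸ e.map_source hpe
  have hes0 : e.symm 0 = p := by rw [← he0, e.left_inv hpe]
  obtain ⟨κ₀, hκ₀, hκe⟩ := Metric.isOpen_iff.mp e.open_source p hpe
  set κ := κ₀ / 4 with hκdef
  have hκ : 0 < κ := by positivity
  have hκsrc : closedBall p (3 * κ) ⊆ e.source :=
    (closedBall_subset_ball (by linarith)).trans hκe
  have hκO : closedBall p (3 * κ) ⊆ O := fun z hz => (hρO (hsrc (hκsrc hz))).1
  have hκv : ∀ z ∈ closedBall p (3 * κ), v z ≠ 0 := fun z hz => (hρO (hsrc (hκsrc hz))).2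
  have hvc : ContinuousOn v (closedBall p (3 * κ)) := hv.continuousOn.mono hκO
  obtain ⟨M₁, hM₁⟩ := (isCompact_closedBall p (3 * κ)).exists_bound_of_continuousOn hvc
  obtain ⟨M₂, hM₂⟩ := (isCompact_closedBall p (3 * κ)).exists_bound_of_continuousOn
    (hvc.inv₀ hκv)
  set M := max 1 (max M₁ M₂) with hM
  have hM1 : 1 ≤ M := le_max_left _ _
  have hvM : ∀ z ∈ closedBall p (3 * κ), ‖v z‖ ≤ M := fun z hz =>
    (hM₁ z hz).trans ((le_max_left _ _).trans (le_max_right _ _))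
  have hvM' : ∀ z ∈ closedBall p (3 * κ), ‖(v z)⁻¹‖ ≤ M := fun z hz =>
    (hM₂ z hz).trans ((le_max_right _ _).trans (le_max_right _ _))
  -- the disc of radius `τ` in the rectified plane corresponds to points close to `p`
  have hev : ∀ᶠ x in 𝓝 (0 : ℂ), x ∈ e.target ∧ e.symm x ∈ ball p κ := by
    have h1 : Tendsto e.symm (𝓝 0) (𝓝 p) := by
      have := (e.continuousAt_symm h0t).tendsto
      rwa [hes0] at this
    filter_upwards [e.open_target.mem_nhds h0t, h1 (ball_mem_nhds p hκ)] with x h2 h3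
      using ⟨h2, h3⟩
  obtain ⟨τ, hτ, hτe⟩ := Metric.eventually_nhds_iff_ball.mp hev
  set B : Set ℂ := {x | x ∈ ball (0 : ℂ) τ ∧ e.symm x ∈ A} with hB
  have hstep : ∀ δ > 0, ∃ ε : ℝ, 0 < ε ∧ ε < δ ∧ ∀ y ∈ B, ‖y‖ < 3 * τ / 4 →
      (∃ y' ∈ B, ‖y' - (y + ε)‖ ≤ δ * ε) ∧ ∃ y' ∈ B, ‖y' - (y - ε)‖ ≤ δ * ε := by
    intro δ₀ hδ₀
    obtain ⟨δ, hδ, hδδ₀, hδ1⟩ : ∃ δ : ℝ, 0 < δ ∧ δ ≤ δ₀ ∧ δ ≤ 1 :=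
      ⟨min δ₀ 1, by positivity, min_le_left _ _, min_le_right _ _⟩
    obtain ⟨δ₁, hδ₁, hδ₁1, hest⟩ := exists_norm_rectified_step_sub_le hκ
      (fun z hz => hζ z (hsrc (hκsrc hz))) hvc hκv hM1 hvM hvM' hδ
    obtain ⟨ε, hε, hεlt, g, hg, hgA⟩ := hsymm
      (min (min δ δ₁) (min (τ / 8) (κ / (6 * (M + 1))))) (by positivity)
    have hεδ : ε < δ := hεlt.trans_le ((min_le_left _ _).trans (min_le_left _ _))
    have hεδ₁ : ε < δ₁ := hεlt.trans_le ((min_le_left _ _).trans (min_le_right _ _))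
    have hετ : ε < τ / 8 := hεlt.trans_le ((min_le_right _ _).trans (min_le_left _ _))
    have hεκ : 6 * (ε * (M + 1)) < κ := by
      have h1 : ε < κ / (6 * (M + 1)) :=
        hεlt.trans_le ((min_le_right _ _).trans (min_le_right _ _))
      rw [lt_div_iff₀ (by positivity)] at h1
      linarith
    have hgδ : ∀ z ∈ O, ‖g z - z - ε * v z‖ ≤ δ₁ * ε := fun z hz =>
      (hgA z hz).2.trans (by
        gcongr
        exact (min_le_left _ _).trans (min_le_right _ _))
    have hκ2 : ball p (2 * κ) ⊆ closedBall p (3 * κ) := fun z hz =>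
      ball_subset_closedBall (ball_subset_ball (by linarith) hz)
    refine ⟨ε, hε, hεδ.trans_le hδδ₀, fun y hy hyτ => ?_⟩
    obtain ⟨hyball, hyA⟩ := hy
    obtain ⟨hyt, hyκ⟩ := hτe y hyball
    set z := e.symm y with hz
    have hez : ζ z = y := by rw [← he]; exact e.right_inv hyt
    have hzκ2 : z ∈ ball p (2 * κ) := ball_subset_ball (by linarith) hyκ
    have hεn : ‖(ε : ℂ)‖ = ε := by rw [Complex.norm_real, Real.norm_eq_abs, abs_of_pos hε]
    -- a point of `A` whose `ζ`-coordinate is close to `y ± ε` gives a point of `B`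
    have hmk : ∀ w ∈ ball p (3 * κ), w ∈ A → ∀ q : ℂ, ‖q‖ ≤ ε → ‖ζ w - (y + q)‖ ≤ δ * ε →
        ζ w ∈ B := by
      intro w hw hwA q hq hwq
      have hws : w ∈ e.source := hκsrc (ball_subset_closedBall hw)
      refine ⟨?_, ?_⟩
      · rw [mem_ball_zero_iff]
        have h1 := norm_add_le (ζ w - (y + q)) (y + q)
        rw [sub_add_cancel] at h1
        have h2 := norm_add_le y q
        nlinarith
      · rw [← he, e.left_inv hws]; exact hwA
    constructor
    · obtain ⟨hw, hwε⟩ := hest ε hε hεδ₁ z hzκ2 (g z) (hgδ z (hκO (hκ2 hzκ2)))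
      have hgz : g z ∈ A := ((hgA z (hκO (hκ2 hzκ2))).1).mp hyA
      rw [hez] at hwε
      have h1 : ‖ζ (g z) - (y + ε)‖ ≤ δ * ε := by rwa [← sub_sub]
      exact ⟨ζ (g z), hmk _ hw hgz ε hεn.le h1, h1.trans (by gcongr)⟩
    · have hsub : ball z (6 * (ε * (M + 1))) ⊆ ball p (2 * κ) := by
        intro u hu
        rw [mem_ball] at hu hyκ ⊢
        linarith [dist_triangle u z p]
      obtain ⟨u, hu, hgu⟩ := exists_preimage_of_norm_sub_self_le (g := g) (z := z)
        (E := ε * (M + 1)) (by positivity)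
        (hg.mono fun u hu => hκO (hκ2 (hsub hu))) (by
          intro u hu
          have hu3 := hκ2 (hsub hu)
          have h1 := norm_add_le (g u - u - ε * v u) (ε * v u)
          rw [sub_add_cancel, norm_mul, hεn] at h1
          nlinarith [hvM u hu3, hgδ u (hκO hu3)])
      have huκ := hsub hu
      have huO := hκO (hκ2 huκ)
      obtain ⟨-, huε⟩ := hest ε hε hεδ₁ u huκ (g u) (hgδ u huO)
      have huA : u ∈ A := (hgA u huO).1.mpr (by rwa [hgu])
      rw [hgu, hez] at huε
      have h1 : ‖ζ u - (y - ε)‖ ≤ δ * ε := by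
        have h2 : ζ u - (y - ε) = -(y - ζ u - ε) := by ring
        rwa [h2, norm_neg]
      exact ⟨ζ u, hmk _ (ball_subset_ball (by linarith) huκ) huA (-ε) (by rw [norm_neg, hεn])
        (by rwa [← sub_eq_add_neg]), h1.trans (by gcongr)⟩
  -- `B` is relatively closed
  have hBcl : ∀ x ∈ ball (0 : ℂ) τ, x ∈ closure B → x ∈ B := by
    intro x hx hxB
    refine ⟨hx, ?_⟩
    by_contra hxA
    obtain ⟨hxt, hxκ⟩ := hτe x hx
    have hxO : e.symm x ∈ O := hκO (ball_subset_closedBall (ball_subset_ball (by linarith) hxκ))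
    have h1 := (e.continuousAt_symm hxt).tendsto.eventually (hcl _ hxO hxA)
    exact mem_closure_iff_frequently.mp hxB (h1.mono fun y hy hyB => hy hyB.2)
  have htrans : ∀ x ∈ ball (0 : ℂ) (τ / 2), x ∈ B → ∀ (t : ℝ) (d : ℂ), 0 ≤ t → (d = 1 ∨ d = -1) →
      x + t * d ∈ ball (0 : ℂ) (τ / 2) → x + t * d ∈ B := by
    intro x hx hxB t d ht hd hxt
    refine hBcl _ (ball_subset_ball (by linarith) hxt) ?_
    refine add_smul_mem_closure_of_approx_steps (ρ := τ / 4) ht (by positivity)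
      (by rcases hd with rfl | rfl <;> simp) hxB fun δ hδ => ?_
    obtain ⟨ε, hε, hεδ, hs⟩ := hstep δ hδ
    refine ⟨ε, hε, hεδ, fun y hy ⟨u, hu, hyu⟩ => ?_⟩
    have hxu : ‖x + u * d‖ < τ / 2 := by
      have hseg : x + u * d ∈ segment ℝ x (x + t * d) := by
        rw [segment_eq_image']
        rcases ht.eq_or_lt with rfl | ht
        · have : u = 0 := le_antisymm hu.2 hu.1
          exact ⟨0, by simp, by simp [this]⟩
        · refine ⟨u / t, ⟨div_nonneg hu.1 ht.le, (div_le_one ht).mpr hu.2⟩, ?_⟩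
          have : (t : ℂ) ≠ 0 := by exact_mod_cast ht.ne'
          simp only [add_sub_cancel_left, Complex.real_smul]
          push_cast
          field_simp
      exact mem_ball_zero_iff.mp ((convex_ball (0 : ℂ) (τ / 2)).segment_subset hx hxt hseg)
    have hyn : ‖y‖ < 3 * τ / 4 := by
      have h1 := norm_add_le (y - (x + u * d)) (x + u * d)
      rw [sub_add_cancel] at h1
      linarith
    rcases hd with rfl | rfl
    · simpa using (hs y hy hyn).1
    · simpa [sub_eq_add_neg] using (hs y hy hyn).2
  let e' := e.symm.restrOpen (ball 0 (τ / 2)) isOpen_ball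
  have hball : ball (0 : ℂ) (τ / 2) ⊆ ball 0 τ := ball_subset_ball (by linarith)
  have hsrc' : e'.source = ball 0 (τ / 2) := by
    change e.symm.source ∩ ball 0 (τ / 2) = _
    exact inter_eq_right.mpr fun z hz => (hτe z (hball hz)).1
  have htgt : e'.target ⊆ e.source := by
    intro x hx
    have h1 : e'.symm x ∈ ball 0 (τ / 2) := hsrc' ▸ e'.map_target hx
    have h2 : e.symm (e'.symm x) = x := e'.right_inv hx
    rw [← h2]
    exact e.map_target (hτe _ (hball h1)).1
  refine ⟨e', τ / 2, by positivity, hsrc', hes0, fun x hx => (hρO (hsrc (htgt hx))).1, ?_, ?_⟩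
  · change DifferentiableOn ℂ e e'.target
    rw [he]
    exact fun x hx => (hζ x (hsrc (htgt hx))).differentiableAt.differentiableWithinAt
  · rw [hsrc']
    intro x hx y hy hxy hxA
    have hxB : x ∈ B := ⟨hball hx, hxA⟩
    rcases le_total x.re y.re with h | h
    · have hy' : y = x + ((y.re - x.re : ℝ) : ℂ) * 1 := by
        apply Complex.ext <;> simp [hxy]
      rw [hy'] at hy ⊢
      exact (htrans x hx hxB _ 1 (sub_nonneg.mpr h) (Or.inl rfl) hy).2
    · have hy' : y = x + ((x.re - y.re : ℝ) : ℂ) * (-1) := by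
        apply Complex.ext <;> simp [hxy]
      rw [hy'] at hy ⊢
      exact (htrans x hx hxB _ (-1) (sub_nonneg.mpr h) (Or.inr rfl) hy).2

/-! ### Laminar pieces -/

/-- A parametrization by a disc in which `K` is invariant under horizontal translations carries a
square onto a laminar piece of `K`. -/
theorem exists_laminar_domain {K : Set ℂ} {e : OpenPartialHomeomorph ℂ ℂ} {s : ℝ}
    (hK : IsCompact K) (hs : 0 < s) (hsrc : e.source = ball 0 s)
    (hesd : DifferentiableOn ℂ e.symm e.target)
    (he0 : e 0 ∈ K)
    (hinv : ∀ x ∈ e.source, ∀ y ∈ e.source, x.im = y.im → e x ∈ K → e y ∈ K) :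
    ∃ Ω : Set ℂ, IsPlaneDomain Ω ∧ IsSimplyConnected Ω ∧ Ω ⊆ e.target ∧ (Ω ∩ K).Nonempty ∧
      ∃ (W : Set ℂ) (ψ : ℂ → ℂ) (L : Set ℝ),
        IsOpen W ∧ closure Ω ⊆ W ∧ DifferentiableOn ℂ ψ W ∧ InjOn ψ W ∧
        IsCompact L ∧ ψ '' (closure Ω ∩ K) = Icc (0 : ℝ) 1 ×ℂ L := by
  set a := s / 4 with ha
  have ha0 : 0 < a := by positivity
  set Q : Set ℂ := Ioo (-a) a ×ℂ Ioo (-a) a with hQ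
  set Q' : Set ℂ := Icc (-a) a ×ℂ Icc (-a) a with hQ'
  have hQQ' : closure Q = Q' := by
    rw [hQ, Complex.closure_reProdIm, closure_Ioo (by linarith)]
  have hQ'c : IsCompact Q' := isCompact_Icc.reProdIm isCompact_Icc
  have hQ's : Q' ⊆ e.source := by
    intro x hx
    rw [hQ', Complex.mem_reProdIm] at hx
    rw [hsrc, mem_ball_zero_iff]
    have h1 : |x.re| ≤ a := abs_le.mpr hx.1
    have h2 : |x.im| ≤ a := abs_le.mpr hx.2
    linarith [Complex.norm_le_abs_re_add_abs_im x]
  have hQs : Q ⊆ e.source := (hQQ' ▸ subset_closure : Q ⊆ Q').trans hQ's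
  have hQo : IsOpen Q := isOpen_Ioo.reProdIm isOpen_Ioo
  have h0Q : (0 : ℂ) ∈ Q := by
    rw [hQ, Complex.mem_reProdIm]; simp [ha0]
  have hQconv : Convex ℝ Q := by
    have : Q = Complex.reLm ⁻¹' Ioo (-a) a ∩ Complex.imLm ⁻¹' Ioo (-a) a := by
      ext x; simp [hQ, Complex.mem_reProdIm]
    rw [this]
    exact ((convex_Ioo _ _).linear_preimage _).inter ((convex_Ioo _ _).linear_preimage _)
  have hclos : closure (e '' Q) = e '' Q' := by
    apply subset_antisymm
    · exact closure_minimal (image_mono (hQQ' ▸ subset_closure))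
        (hQ'c.image_of_continuousOn (e.continuousOn.mono hQ's)).isClosed
    · have := (e.continuousOn.mono (hQQ' ▸ hQ's : closure Q ⊆ e.source)).image_closure
      rwa [hQQ'] at this
  have hcont : ContractibleSpace (e '' Q) := by
    have := hQconv.contractibleSpace ⟨0, h0Q⟩
    exact (e.homeomorphOfImageSubsetSource hQs rfl).symm.contractibleSpace
  have hsc : IsSimplyConnected (e '' Q) := by
    unfold IsSimplyConnected; infer_instance
  have hcl : closure (e '' Q) ⊆ e.target := by
    rw [hclos]; rintro _ ⟨x, hx, rfl⟩; exact e.map_source (hQ's hx)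
  -- the affine map sending the side `[-a, a]` onto `[0, 1]`
  set ψ : ℂ → ℂ := fun z => ((2 * a : ℝ) : ℂ)⁻¹ * e.symm z + (1 / 2 : ℝ) with hψ
  have h2a : ((2 * a : ℝ) : ℂ)⁻¹ ≠ 0 := inv_ne_zero (by exact_mod_cast (by positivity))
  have hψre : ∀ x ∈ Q', (ψ (e x)).re = (2 * a)⁻¹ * x.re + 1 / 2 := by
    intro x hx
    rw [hψ]
    simp only [e.left_inv (hQ's hx), ← Complex.ofReal_inv, Complex.add_re, Complex.re_ofReal_mul,
      Complex.ofReal_re]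
  have hψim : ∀ x ∈ Q', (ψ (e x)).im = (2 * a)⁻¹ * x.im := by
    intro x hx
    rw [hψ]
    simp only [e.left_inv (hQ's hx), ← Complex.ofReal_inv, Complex.add_im, Complex.im_ofReal_mul,
      Complex.ofReal_im, add_zero]
  have hψd : DifferentiableOn ℂ ψ e.target := (hesd.const_mul _).add_const _
  refine ⟨e '' Q, ⟨e.isOpen_image_of_subset_source hQo hQs, hsc.isPathConnected.isConnected⟩, hsc,
    subset_closure.trans hcl, ⟨e 0, mem_image_of_mem _ h0Q, he0⟩, e.target, ψ,
    Complex.im '' (ψ '' (closure (e '' Q) ∩ K)), e.open_target, hcl, hψd, ?_, ?_, ?_⟩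
  · intro x hx y hy hxy
    exact e.symm.injOn hx hy (mul_left_cancel₀ h2a (add_right_cancel hxy))
  · refine IsCompact.image ?_ Complex.continuous_im
    refine IsCompact.image_of_continuousOn ?_ (hψd.continuousOn.mono (inter_subset_left.trans hcl))
    rw [hclos]
    exact (hQ'c.image_of_continuousOn (e.continuousOn.mono hQ's)).inter hK
  · rw [hclos]
    ext w
    rw [Complex.mem_reProdIm]
    constructor
    · intro hw
      refine ⟨?_, mem_image_of_mem _ hw⟩
      obtain ⟨_, ⟨⟨x, hx, rfl⟩, -⟩, rfl⟩ := hw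
      rw [hψre x hx]
      obtain ⟨h1, h2⟩ := (Complex.mem_reProdIm.mp hx).1
      constructor
      · have : (2 * a)⁻¹ * (-a) ≤ (2 * a)⁻¹ * x.re := by gcongr
        have h3 : (2 * a)⁻¹ * (-a) = -(1 / 2) := by field_simp
        linarith
      · have : (2 * a)⁻¹ * x.re ≤ (2 * a)⁻¹ * a := by gcongr
        have h3 : (2 * a)⁻¹ * a = 1 / 2 := by field_simp
        linarith
    · rintro ⟨⟨hw0, hw1⟩, _, ⟨_, ⟨⟨x, hx, rfl⟩, hxK⟩, rfl⟩, him⟩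
      rw [hψim x hx] at him
      set y : ℂ := ⟨2 * a * (w.re - 1 / 2), x.im⟩ with hy
      have hyQ : y ∈ Q' := by
        rw [hQ', Complex.mem_reProdIm]
        refine ⟨⟨?_, ?_⟩, (Complex.mem_reProdIm.mp hx).2⟩ <;> simp only [hy] <;> nlinarith
      refine ⟨e y, ⟨mem_image_of_mem _ hyQ, hinv x (hQ's hx) y (hQ's hyQ) rfl hxK⟩, ?_⟩
      apply Complex.ext
      · rw [hψre y hyQ]
        simp only [hy]
        field_simp
        ring
      · rw [hψim y hyQ, ← him]

/-! ### Symmetries close to the identity, and the dichotomy -/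

lemma IsLocalSymmetry.mem_iff_apply_mem {K D : Set ℂ} {H : ℂ → ℂ} (h : IsLocalSymmetry K D H)
    {x : ℂ} (hx : x ∈ D) : x ∈ K ↔ H x ∈ K := by
  simpa [hx, mem_image_of_mem H hx] using h.mem_iff x hx

/-- Let `h n` converge to `h`, with `h' ≠ 0` at `0`, and let every `h n` carry `A` to `K` and the
complement of `A` to that of `K`. Then the maps `h⁻¹ ∘ h n` are symmetries of `A` near `0` that
converge to the identity. The limit `h` itself carries the complement of `A` to that of `K`
because `h⁻¹ ∘ h n`, being close to the identity, is locally onto. -/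
theorem exists_near_identity_symmetries {A K O : Set ℂ} {h : ℕ → ℂ → ℂ} {h₀ : ℂ → ℂ}
    (hO : IsOpen O) (h0 : (0 : ℂ) ∈ O) (hK : IsClosed K)
    (hcl : ∀ x ∈ O, x ∉ A → ∀ᶠ u in 𝓝 x, u ∉ A) (hd : ∀ n, DifferentiableOn ℂ (h n) O)
    (hlim : TendstoLocallyUniformlyOn h h₀ atTop O) (hder : deriv h₀ 0 ≠ 0)
    (hA : ∀ n, ∀ z ∈ O, (z ∈ A ↔ h n z ∈ K)) :
    ∃ r > 0, r ≤ 1 ∧ closedBall 0 r ⊆ O ∧ ∀ η > 0, ∃ N, ∀ n ≥ N, ∃ f : ℂ → ℂ,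
      DifferentiableOn ℂ f (ball 0 r) ∧
      (∀ z ∈ ball (0 : ℂ) r, (z ∈ A ↔ f z ∈ A) ∧ ‖f z - z‖ ≤ η) ∧
      ((∀ᶠ z in 𝓝 0, f z = z) → ∀ᶠ z in 𝓝 0, h n z = h₀ z) := by
  have hd₀ : DifferentiableOn ℂ h₀ O := hlim.differentiableOn (.of_forall hd) hO
  obtain ⟨e, he, h0e, hsrc, hesd⟩ :=
    exists_biholomorphic_openPartialHomeomorph hO hd₀ h0 hder
  obtain ⟨r₁, hr₁, hr₁e⟩ := Metric.nhds_basis_closedBall.mem_iff.mp (e.open_source.mem_nhds h0e)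
  -- `h⁻¹ ∘ h n` is defined and close to the identity on the closed disc, for large `n`
  have hclose : ∀ η > 0, ∃ N, ∀ n ≥ N, ∀ z ∈ closedBall (0 : ℂ) r₁,
      h n z ∈ e.target ∧ ‖e.symm (h n z) - z‖ ≤ η := by
    intro η hη
    have hC : IsCompact (h₀ '' closedBall 0 r₁) :=
      (isCompact_closedBall _ _).image_of_continuousOn (hd₀.continuousOn.mono (hr₁e.trans hsrc))
    have hCt : h₀ '' closedBall 0 r₁ ⊆ e.target := by
      rintro _ ⟨z, hz, rfl⟩
      rw [← he]; exact e.map_source (hr₁e hz)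
    obtain ⟨δ, hδ, hδt⟩ := hC.exists_cthickening_subset_open e.open_target hCt
    have huc := hC.cthickening (r := δ) |>.uniformContinuousOn_of_continuous
      (e.symm.continuousOn.mono hδt)
    obtain ⟨τ, hτ, huc⟩ := Metric.uniformContinuousOn_iff.mp huc η hη
    have hun := (tendstoLocallyUniformlyOn_iff_forall_isCompact hO).mp hlim _
      (hr₁e.trans hsrc) (isCompact_closedBall _ _)
    obtain ⟨N, hN⟩ := eventually_atTop.mp
      (Metric.tendstoUniformlyOn_iff.mp hun (min δ τ) (lt_min hδ hτ))
    refine ⟨N, fun n hn z hz => ?_⟩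
    have h1 := hN n hn z hz
    rw [dist_comm] at h1
    have h2 : h₀ z ∈ h₀ '' closedBall 0 r₁ := mem_image_of_mem _ hz
    have h3 : h n z ∈ cthickening δ (h₀ '' closedBall 0 r₁) :=
      mem_cthickening_of_dist_le _ _ _ _ h2 (h1.le.trans (min_le_left _ _))
    refine ⟨hδt h3, ?_⟩
    have h4 := huc _ h3 _ (self_subset_cthickening _ h2) (h1.trans_le (min_le_right _ _))
    have h5 : e.symm (h₀ z) = z := by rw [← he]; exact e.left_inv (hr₁e hz)
    rw [h5, dist_eq_norm] at h4
    exact h4.le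
  have hfd : ∀ n, (∀ z ∈ closedBall (0 : ℂ) r₁, h n z ∈ e.target) →
      DifferentiableOn ℂ (fun z => e.symm (h n z)) (closedBall 0 r₁) := fun n hn =>
    hesd.comp ((hd n).mono (hr₁e.trans hsrc)) hn
  have hhe : ∀ y ∈ e.target, h₀ (e.symm y) = y := by
    intro y hy
    rw [← he]; exact e.right_inv hy
  have hA₀ : ∀ z ∈ ball (0 : ℂ) r₁, (z ∈ A ↔ h₀ z ∈ K) := by
    intro z hz
    have hzO : z ∈ O := hsrc (hr₁e (ball_subset_closedBall hz))
    constructor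
    · intro hzA
      exact hK.mem_of_tendsto (hlim.tendsto_at hzO) (.of_forall fun n => (hA n z hzO).mp hzA)
    · intro hzK
      by_contra hzA
      obtain ⟨τ, hτ, hτb⟩ := Metric.eventually_nhds_iff_ball.mp
        ((hcl z hzO hzA).and (isOpen_ball.mem_nhds hz))
      obtain ⟨N, hN⟩ := hclose (τ / 6) (by positivity)
      have hsub : ball z (6 * (τ / 6)) ⊆ closedBall 0 r₁ := by
        intro u hu
        exact ball_subset_closedBall (hτb u (by rwa [mul_div_cancel₀ _ (by norm_num)] at hu)).2
      obtain ⟨u, hu, hfu⟩ := exists_preimage_of_norm_sub_self_le (z := z) (E := τ / 6)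
        (by positivity) ((hfd N fun w hw => (hN N le_rfl w hw).1).mono hsub)
        (fun u hu => (hN N le_rfl u (hsub hu)).2)
      have huτ : u ∈ ball z τ := by rwa [mul_div_cancel₀ _ (by norm_num)] at hu
      have huK : h N u ∈ K := by
        rw [← hhe _ (hN N le_rfl u (hsub hu)).1]
        simpa only [hfu] using hzK
      exact (hτb u huτ).1 ((hA N u (hsrc (hr₁e (hsub hu)))).mpr huK)
  set r := min (r₁ / 2) 1 with hr
  have hr0 : 0 < r := by positivity
  have hrr₁ : r ≤ r₁ / 2 := min_le_left _ _
  have hrsub : ball (0 : ℂ) r ⊆ ball 0 r₁ := ball_subset_ball (by linarith)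
  refine ⟨r, hr0, min_le_right _ _, ?_, fun η hη => ?_⟩
  · exact (closedBall_subset_closedBall (by linarith)).trans (hr₁e.trans hsrc)
  obtain ⟨N, hN⟩ := hclose (min η (r₁ / 4)) (by positivity)
  refine ⟨N, fun n hn => ⟨fun z => e.symm (h n z),
    (hfd n fun z hz => (hN n hn z hz).1).mono (hrsub.trans ball_subset_closedBall),
    fun z hz => ?_, fun hev => ?_⟩⟩
  · obtain ⟨h1, h2⟩ := hN n hn z (ball_subset_closedBall (hrsub hz))
    refine ⟨?_, h2.trans (min_le_left _ _)⟩
    have h3 : e.symm (h n z) ∈ ball (0 : ℂ) r₁ := by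
      rw [mem_ball_zero_iff] at hz ⊢
      have h4 := norm_add_le (e.symm (h n z) - z) z
      rw [sub_add_cancel] at h4
      linarith [min_le_right η (r₁ / 4)]
    rw [hA₀ _ h3, hhe _ h1]
    exact hA n z (hsrc (hr₁e (ball_subset_closedBall (hrsub hz))))
  · filter_upwards [hev, closedBall_mem_nhds (0 : ℂ) hr₁] with z hz hzr
    rw [← hhe _ (hN n hn z hzr).1, hz]

/-- Attracting fixed points are so plentiful that one can be found in any open set meeting `K`
away from the critical points of a given nonconstant holomorphic function. -/
lemma exists_attractingFixedPoint_deriv_ne_zero {K U V : Set ℂ} {H : ℂ → ℂ} (hperf : Preperfect K)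
    (hU : IsPlaneDomain U) (hJ : IsJLikeRelativeTo K U) (hH : DifferentiableOn ℂ H U)
    (hconst : ¬ ∃ c, ∀ z ∈ U, H z = c) (hV : IsOpen V) (hVU : V ⊆ U) (hVK : (V ∩ K).Nonempty) :
    ∃ b ∈ V ∩ K, b ∈ attractingFixedPoints K ∧ deriv H b ≠ 0 := by
  obtain ⟨hUo, hUc⟩ := hU
  obtain ⟨x₀, hx₀V, hx₀K⟩ := hVK
  have hd' : DifferentiableOn ℂ (deriv H) U := hH.deriv hUo
  have hne : ∀ᶠ z in 𝓝[≠] x₀, deriv H z ≠ 0 := by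
    refine ((hd'.analyticAt (hUo.mem_nhds (hVU hx₀V))).eventually_eq_zero_or_eventually_ne_zero
      ).resolve_left fun hz => hconst ?_
    have h0 : EqOn (deriv H) 0 U :=
      (hd'.analyticOnNhd hUo).eqOn_zero_of_preconnected_of_eventuallyEq_zero
        hUc.isPreconnected (hVU hx₀V) hz
    exact hUo.exists_is_const_of_deriv_eq_zero hUc.isPreconnected hH h0
  have hfr := accPt_iff_frequently.mp (hperf x₀ hx₀K)
  obtain ⟨x₁, ⟨hx₁, hx₁K⟩, hx₁d, hx₁V⟩ := (hfr.and_eventually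
    ((eventually_nhdsWithin_iff.mp hne).and (hV.mem_nhds hx₀V))).exists
  have hWo : IsOpen (V ∩ deriv H ⁻¹' {0}ᶜ) :=
    (hd'.continuousOn.mono hVU).isOpen_inter_preimage hV isOpen_compl_singleton
  obtain ⟨b, ⟨hbV, hbd⟩, hbA, -, hbK⟩ := _root_.mem_closure_iff.mp (hJ ⟨hVU hx₁V, hx₁K⟩) _ hWo
    ⟨hx₁V, hx₁d hx₁⟩
  exact ⟨b, ⟨hbV, hbK⟩, hbA, hbd⟩

theorem theorem2p3 (K U : Set ℂ) (hK : IsCompact K) (hperf : Preperfect K)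
    (hU : IsPlaneDomain U) (hJ : IsJLikeRelativeTo K U) :
    (∀ F : Set (ℂ → ℂ), IsNontrivialSymmetryFamily K U F → (U.domRestrict '' F).Finite) ∨
      IsLaminarRelativeTo K U := by
  refine or_iff_not_imp_left.mpr fun hinf => ?_
  push Not at hinf
  obtain ⟨F, hF, hFinf⟩ := hinf
  -- a convergent sequence of symmetries that are pairwise distinct on `U`
  have hex : ∀ n : ℕ, ∃ H ∈ F, U.domRestrict H = (hFinf.natEmbedding _ n : U → ℂ) := fun n =>
    (hFinf.natEmbedding _ n).2
  choose H₁ hH₁F hH₁ using hex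
  obtain ⟨φ, hφ, H₀, hlim⟩ := hF.normal H₁ hH₁F
  set H : ℕ → ℂ → ℂ := fun k => H₁ (φ k) with hHdef
  have hHF : ∀ n, H n ∈ F := fun n => hH₁F _
  have hHsym : ∀ n, IsLocalSymmetry K U (H n) := fun n => hF.isLocalSymmetry _ (hHF n)
  have hHd : ∀ n, DifferentiableOn ℂ (H n) U := fun n => (hHsym n).differentiableOn
  have hHne : ∀ m n, EqOn (H m) (H n) U → m = n := by
    intro m n hmn
    apply hφ.injective
    apply (hFinf.natEmbedding _).injective
    apply Subtype.ext
    rw [← hH₁, ← hH₁]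
    exact funext fun x => hmn x.2
  have hH₀d : DifferentiableOn ℂ H₀ U := hlim.differentiableOn (.of_forall hHd) hU.1
  have hconst : ¬ ∃ c, ∀ z ∈ U, H₀ z = c := hF.limit_not_constant H hHF H₀ hlim
  intro V hV hVU hVK
  obtain ⟨b, ⟨hbV, hbK⟩, ⟨D, G, hG, hGb⟩, hbd⟩ :=
    exists_attractingFixedPoint_deriv_ne_zero hperf hU hJ hH₀d hconst hV hVU hVK
  -- the Koenigs coordinate, in which `K` becomes a set `A` invariant under multiplication by `G' b`
  obtain ⟨e, R, hR, hsrc, he0, htgt, hed, hesd, hed0, hconj⟩ := exists_koenigs_parametrization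
    hG.isPlaneDomain.1 hG.differentiableOn hGb (hV.mem_nhds hbV)
  set A : Set ℂ := {z | e z ∈ K}
  have h0R : (0 : ℂ) ∈ ball (0 : ℂ) R := mem_ball_self hR
  have hmaps : ∀ z ∈ ball (0 : ℂ) R, e z ∈ D ∩ V := fun z hz =>
    htgt (e.map_source (hsrc.symm ▸ hz))
  have hmapsU : MapsTo e (ball 0 R) U := fun z hz => hVU (hmaps z hz).2
  have hAl : ∀ z ∈ ball (0 : ℂ) R, (z ∈ A ↔ deriv G b * z ∈ A) := by
    intro z hz
    change e z ∈ K ↔ e (deriv G b * z) ∈ K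
    rw [hconj z hz]
    exact hG.mem_iff_apply_mem (hmaps z hz).1
  have hAcl : ∀ x ∈ ball (0 : ℂ) R, x ∉ A → ∀ᶠ u in 𝓝 x, u ∉ A := fun x hx hxA =>
    (hed.continuousOn.continuousAt (isOpen_ball.mem_nhds hx)).eventually
      (hK.isClosed.isOpen_compl.mem_nhds hxA)
  have hder : deriv (fun z => H₀ (e z)) 0 ≠ 0 := by
    have h1 : HasDerivAt H₀ (deriv H₀ b) (e 0) := by
      rw [he0]
      exact (hH₀d.differentiableAt (hU.1.mem_nhds (hVU hbV))).hasDerivAt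
    have h2 := h1.comp 0 (hed.differentiableAt (isOpen_ball.mem_nhds h0R)).hasDerivAt
    rw [show deriv (fun z => H₀ (e z)) 0 = _ from h2.deriv]
    exact mul_ne_zero hbd hed0
  obtain ⟨r, hr0, hr1, hrR, hnear⟩ := exists_near_identity_symmetries
    (h := fun n z => H n (e z)) (h₀ := fun z => H₀ (e z)) (A := A) isOpen_ball h0R hK.isClosed
    hAcl (fun n => (hHd n).comp hed hmapsU) (hlim.comp e hmapsU hed.continuousOn) hder
    (fun n z hz => (hHsym n).mem_iff_apply_mem (hmapsU hz))
  have hrR' : r < R := by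
    have : (r : ℂ) ∈ ball (0 : ℂ) R := hrR (by simp [abs_of_pos hr0])
    simpa [abs_of_pos hr0] using this
  have hbt : b ∈ e.target := he0 ▸ e.map_source (hsrc.symm ▸ h0R)
  have hsymm0 : Tendsto e.symm (𝓝 b) (𝓝 0) := by
    have h1 := (e.continuousAt_symm hbt).tendsto
    have h2 : e.symm b = 0 := by rw [← he0, e.left_inv (hsrc.symm ▸ h0R)]
    rwa [h2] at h1
  -- near the fixed point, a germ agrees with that of the limit for at most one index
  have hgerm : ∀ n, (∀ᶠ z in 𝓝 0, H n (e z) = H₀ (e z)) → EqOn (H n) H₀ U := by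
    intro n hn
    refine ((hHd n).analyticOnNhd hU.1).eqOn_of_preconnected_of_eventuallyEq
      (hH₀d.analyticOnNhd hU.1) hU.2.isPreconnected (hVU hbV) ?_
    filter_upwards [hsymm0.eventually hn, e.open_target.mem_nhds hbt] with x hx hxt
    rwa [e.right_inv hxt] at hx
  obtain ⟨c, m, hc, hinfsym⟩ := exists_isInfinitesimalSymmetry_monomial
    (𝓕 := {f | DifferentiableOn ℂ f (ball 0 r) ∧ (∀ z ∈ ball (0 : ℂ) r, (z ∈ A ↔ f z ∈ A)) ∧
      ¬ ∀ᶠ z in 𝓝 0, f z = z}) hr0 hr1 hrR' (norm_pos_iff.mp hGb.2.2.1) hGb.2.2.2 hAl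
    (fun f hf => hf.1) (fun f hf => hf.2.2) (fun f hf => hf.2.1) (by
      intro η hη
      obtain ⟨N, hN⟩ := hnear η hη
      obtain ⟨n, hn, hne⟩ : ∃ n ≥ N, ¬ ∀ᶠ z in 𝓝 0, H n (e z) = H₀ (e z) := by
        by_contra! hall
        have h1 := hgerm N (hall N le_rfl)
        have h2 := hgerm (N + 1) (hall (N + 1) (Nat.le_succ N))
        have := hHne N (N + 1) (h1.trans h2.symm)
        omega
      obtain ⟨f, hfd, hf, hfe⟩ := hN n hn
      exact ⟨f, ⟨hfd, fun z hz => (hf z hz).1, fun hev => hne (hfe hev)⟩,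
        fun z hz => (hf z hz).2⟩)
  -- a point of `A` at which the monomial vector field does not vanish
  obtain ⟨p, hpr, hpA, hp0⟩ : ∃ p ∈ ball (0 : ℂ) r, p ∈ A ∧ p ≠ 0 := by
    obtain ⟨y, ⟨hyb, hyK⟩, hyr, hyt⟩ := ((accPt_iff_frequently.mp (hperf b hbK)).and_eventually
      ((hsymm0.eventually (ball_mem_nhds 0 hr0)).and (e.open_target.mem_nhds hbt))).exists
    have hey : e (e.symm y) = y := e.right_inv hyt
    refine ⟨e.symm y, hyr, by change e (e.symm y) ∈ K; rwa [hey], fun h0 => hyb ?_⟩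
    rw [← hey, h0, he0]
  obtain ⟨e₁, s, hs, hsrc₁, he₁0, htgt₁, hesd₁, hinv⟩ := exists_rectifying_parametrization
    isOpen_ball (by fun_prop) hinfsym hpr
    (mul_ne_zero (norm_ne_zero_iff.mp (by rw [hc]; exact one_ne_zero)) (pow_ne_zero _ hp0))
    (fun x hx => hAcl x (ball_subset_ball hrR'.le hx))
  have hsub : e₁.target ⊆ e.source := by
    rw [hsrc]; exact htgt₁.trans (ball_subset_ball hrR'.le)
  have hsrc₂ : (e₁.trans e).source = e₁.source := by
    rw [OpenPartialHomeomorph.trans_source]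
    exact inter_eq_left.mpr fun x hx => hsub (e₁.map_source hx)
  obtain ⟨Ω, hΩ, hΩs, hΩt, hΩK, W, ψ, L, h⟩ := exists_laminar_domain (e := e₁.trans e) hK hs
    (hsrc₂.trans hsrc₁) (by
      rw [OpenPartialHomeomorph.trans_target]
      exact hesd₁.comp (hesd.mono inter_subset_left) fun x hx => hx.2)
    (by change e (e₁ 0) ∈ K; rwa [he₁0])
    (by
      rw [hsrc₂]
      intro x hx y hy hxy hxK
      exact hinv x hx y hy hxy hxK)
  refine ⟨Ω, hΩ, hΩs, fun x hx => ?_, hΩK, W, ψ, L, h⟩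
  have h1 := hΩt hx
  rw [OpenPartialHomeomorph.trans_target] at h1
  exact (htgt h1.1).2
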